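/- Let $d$ be the discriminant of a real quadratic field $\mathbb Q(\sqrt D)$, and let $\chi_d(n)=\left(\frac dn\right)$ be the Kronecker symbol. For $\operatorname{Im}\tau>0$ and $q=e^{2\pi i\tau}$ let $$\theta_1(z|\tau)=2q^{1/8}\sum_{n=0}^\infty(-1)^nq^{n(n+1)/2}\sin\big((2n+1)z\big),\qquad q^{1/8}=e^{2\pi i\tau/8},$$ let $\frac{\theta_1'}{\theta_1}(z|\tau)$ denote its logarithmic derivative with respect to $z$, and put $$g(z|\tau;\chi_d)=\sum_{k=1}^{d-1}\chi_d(k)\,\frac{\theta_1'}{\theta_1}(z+k\pi\tau\,|\,d\tau).$$ Let $\operatorname{Im}\tau>0$ and let $z\in\mathbb C$ satisfy $|\operatorname{Im}z|<\pi\operatorname{Im}\tau$ and $z\neq k\pi/d$ for every integer $k$ coprime to $d$. Then $\theta_1\big(\frac z\tau-\frac{k\pi}{d\tau}\big|-\frac1\tau\big)\neq0$ for all $1\le k\le d-1$ coprime to $d$ (so the left-hand side below is defined), the series on the right-hand side below converges absolutely, and $$\frac1\tau\, g\Big(\frac z\tau\Big|-\frac1{d\tau};\chi_d\Big)=\sum_{k=1}^{d-1}\chi_d(k)\cot\Big(z-\frac{k\pi}d\Big)+4\sqrt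 d\,\sum_{n=1}^\infty\chi_d(n)\,\frac{q^n}{1-q^n}\,\sin 2nz .$$ -/

import Mathlib

noncomputable section

namespace EvenCharElliptic

/-- The nome `q = exp(2πiτ)`. -/
def nome (τ : ℂ) : ℂ := Complex.exp (2 * Real.pi * Complex.I * τ)

/-- The Jacobi theta function
`θ₁(z|τ) = 2 q^(1/8) ∑_{n ≥ 0} (-1)^n q^(n(n+1)/2) sin((2n+1)z)`, where `q = exp(2πiτ)` and
`q^(1/8)` means `exp(2πiτ/8)`. The exponent `n * (n + 1) / 2` is an exact division in `ℕ`. -/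
def theta1 (z τ : ℂ) : ℂ :=
  2 * Complex.exp (2 * Real.pi * Complex.I * τ / 8) *
    ∑' n : ℕ, (-1 : ℂ) ^ n * nome τ ^ (n * (n + 1) / 2) * Complex.sin ((2 * (n : ℂ) + 1) * z)

/-- The logarithmic derivative `θ₁'(z|τ) / θ₁(z|τ)`, the derivative being taken in `z`. -/
def theta1LogDeriv (z τ : ℂ) : ℂ := deriv (fun w : ℂ => theta1 w τ) z / theta1 z τ

/-- `g(z|τ; χ) = ∑_{k=1}^{N-1} χ(k) (θ₁'/θ₁)(z + kπτ | Nτ)`, for a function `χ` on the integers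
(in the applications, a Dirichlet character modulo `N` extended to `ℤ`). -/
def g (N : ℕ) (χ : ℤ → ℂ) (z τ : ℂ) : ℂ :=
  ∑ k ∈ Finset.Ico 1 N, χ (k : ℤ) * theta1LogDeriv (z + (k : ℂ) * Real.pi * τ) ((N : ℂ) * τ)

/-- The Kronecker symbol `(a/n)` for integers `a`, `n`. For `n ≠ 0`, write `n = s * 2^e * m` with
`s = ±1` and `m` odd and positive; then `(a/n) = (a/s) (a/2)^e (a/m)`, where `(a/m)` is the Jacobi
symbol, `(a/s)` is `-1` if both `s` and `a` are negative and `1` otherwise, and `(a/2)` is `0` for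
even `a`, `1` for `a ≡ ±1 mod 8` and `-1` for `a ≡ ±3 mod 8` (the value of `ZMod.χ₈`). Moreover
`(a/0)` is `1` if `a = ±1` and `0` otherwise. -/
def kroneckerSymbol (a n : ℤ) : ℤ :=
  if n = 0 then (if a.natAbs = 1 then 1 else 0)
  else (if n < 0 ∧ a < 0 then -1 else 1) *
    ZMod.χ₈ (a : ZMod 8) ^ (padicValNat 2 n.natAbs) *
    jacobiSym a (n.natAbs / 2 ^ (padicValNat 2 n.natAbs))

/-- The character `χ_d(n) = (d/n)` (Kronecker symbol), with complex values. -/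
def chi (d : ℤ) (n : ℤ) : ℂ := (kroneckerSymbol d n : ℂ)

end EvenCharElliptic

end

/-! The inversion `τ ↦ -1/τ` multiplies `θ₁` by a constant times `exp(i w² / (πτ))`, so its
logarithmic derivative acquires only the linear term `2iw/(πτ)` (`theta1LogDeriv_div`). At `w = z -
kπ/d`, weighted by `χ_d(k)` and summed, this term disappears: `∑ χ_d(k) = 0` because the character
is nontrivial, and `∑ k χ_d(k) = 0` because it is even. What is left is a character sum of `θ₁'/θ₁`
at modulus `τ`.

The triple product and a Lambert series give `θ₁'/θ₁ = cot w + 4 ∑ qⁿ/(1-qⁿ) sin 2nw` in the strip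
(`hasSum_theta1LogDeriv`). Averaging `sin 2n(z - kπ/d)` against `χ_d(k)` yields `χ_d(n) √d sin 2nz`,
a Gauss sum evaluation (`sum_Ico_mul_sin`).

The arithmetic inputs are that `χ_d` is a real primitive even character (`exists_primitive_chi`),
since a quadratic discriminant is fundamental, and that its Gauss sum `G` is `+√d` (`gaussSum_chi`).
Fourier inversion gives `G² = d`. For the sign, Landsberg–Schaar reciprocity gives certain quadratic
sums modulo `2d`, attached to a prime `p`, the real part `(d/p) √d`. These sums depend only on `p`
modulo `4d`, so Dirichlet's theorem covers every odd unit. Their twist by `χ_d` has positive real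
part and is also a nonnegative multiple of `G`. -/

open scoped NumberTheorySymbols
open Filter Topology

/-! ### Quadratic discriminants are fundamental. -/

open NumberField in
/-- The ring of integers of a quadratic field has a `ℤ`-basis of the form `1, α`. -/
theorem exists_basis_one_of_finrank_eq_two (K : Type*) [Field K] [NumberField K]
    (hK : Module.finrank ℚ K = 2) :
    ∃ (α : 𝓞 K) (b : Module.Basis (Fin 2) ℤ (𝓞 K)), b 0 = 1 ∧ b 1 = α := by
  classical
  have hr : Module.finrank ℤ (𝓞 K) = 2 := by rw [RingOfIntegers.rank, hK]
  let b : Module.Basis (Fin 2) ℤ (𝓞 K) := Module.finBasisOfFinrankEq ℤ (𝓞 K) hr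
  obtain ⟨x, y, hxy⟩ : ∃ x y : ℤ, (1 : 𝓞 K) = x • b 0 + y • b 1 := by
    refine ⟨b.repr 1 0, b.repr 1 1, ?_⟩
    have := b.sum_repr 1
    rw [Fin.sum_univ_two] at this
    exact this.symm
  -- A common divisor `e` of the coordinates of `1` divides `1`, so its norm `e ^ 2` is a unit of
  -- `ℤ`.
  have hcop : IsCoprime x y := by
    rw [Int.isCoprime_iff_gcd_eq_one]
    obtain ⟨x', hx'⟩ : ((Int.gcd x y : ℕ) : ℤ) ∣ x := Int.gcd_dvd_left ..
    obtain ⟨y', hy'⟩ : ((Int.gcd x y : ℕ) : ℤ) ∣ y := Int.gcd_dvd_right ..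
    set e : ℤ := ((Int.gcd x y : ℕ) : ℤ) with he
    set β : 𝓞 K := x' • b 0 + y' • b 1
    have h1 : (algebraMap ℤ (𝓞 K) e) * β = 1 := by
      rw [hxy, hx', hy', ← Algebra.smul_def, smul_add, smul_smul, smul_smul]
    have h2 : IsUnit (Algebra.norm ℤ (algebraMap ℤ (𝓞 K) e)) :=
      (IsUnit.of_mul_eq_one _ h1).map _
    rw [Algebra.norm_algebraMap, hr, isUnit_pow_iff two_ne_zero, Int.isUnit_iff] at h2
    omega
  obtain ⟨u, v, huv⟩ := hcop
  -- The rows `(x, y)` and `(-v, u)` have determinant `u * x + v * y = 1`, so passing to `1, α` is a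
  -- unimodular change of basis.
  set α : 𝓞 K := -v • b 0 + u • b 1
  have h0 : b 0 = u • 1 + (-y) • α := by
    have h : (u * x + v * y) • b 0 = b 0 := by rw [huv, one_smul]
    rw [← h, hxy]; simp only [α]; module
  have h1 : b 1 = v • 1 + x • α := by
    have h : (u * x + v * y) • b 1 = b 1 := by rw [huv, one_smul]
    rw [← h, hxy]; simp only [α]; module
  have hspan : ⊤ ≤ Submodule.span ℤ (Set.range ![(1 : 𝓞 K), α]) := by
    rw [← b.span_eq, Submodule.span_le]
    have m0 : (1 : 𝓞 K) ∈ Submodule.span ℤ (Set.range ![(1 : 𝓞 K), α]) :=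
      Submodule.subset_span ⟨0, rfl⟩
    have m1 : α ∈ Submodule.span ℤ (Set.range ![(1 : 𝓞 K), α]) :=
      Submodule.subset_span ⟨1, rfl⟩
    rintro _ ⟨i, rfl⟩
    fin_cases i
    · change b 0 ∈ _
      rw [h0]
      exact add_mem (Submodule.smul_mem _ _ m0) (Submodule.smul_mem _ _ m1)
    · change b 1 ∈ _
      rw [h1]
      exact add_mem (Submodule.smul_mem _ _ m0) (Submodule.smul_mem _ _ m1)
  refine ⟨α, basisOfTopLeSpanOfCardEqFinrank ![1, α] hspan (by simp [hr]), ?_, ?_⟩ <;> simp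

open NumberField in
/-- The discriminant of a quadratic field is the discriminant `s² + 4t` of the minimal polynomial
of a generator of its ring of integers. -/
theorem exists_generator_discr_eq (K : Type*) [Field K] [NumberField K]
    (hK : Module.finrank ℚ K = 2) :
    ∃ (α : 𝓞 K) (s t : ℤ), α ^ 2 = s * α + t ∧ (∀ β : 𝓞 K, ∃ a b : ℤ, β = a + b * α) ∧
      (∀ a b : ℤ, (a : 𝓞 K) + b * α = 0 → a = 0 ∧ b = 0) ∧ discr K = s ^ 2 + 4 * t := by
  classical
  obtain ⟨α, b, hb0, hb1⟩ := exists_basis_one_of_finrank_eq_two K hK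
  have hspan : ∀ β : 𝓞 K, ∃ x y : ℤ, β = x + y * α := fun β => by
    refine ⟨b.repr β 0, b.repr β 1, ?_⟩
    have := b.sum_repr β
    rw [Fin.sum_univ_two, hb0, hb1] at this
    simpa using this.symm
  have hind : ∀ x y : ℤ, (x : 𝓞 K) + y * α = 0 → x = 0 ∧ y = 0 := fun x y h => by
    have := Fintype.linearIndependent_iff.1 b.linearIndependent ![x, y]
      (by simpa [Fin.sum_univ_two, hb0, hb1] using h)
    exact ⟨this 0, this 1⟩
  obtain ⟨t, s, hst⟩ := hspan (α ^ 2)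
  refine ⟨α, s, t, by rw [hst]; ring, hspan, hind, ?_⟩
  have r1 : b.repr 1 = Finsupp.single 0 1 := by rw [← hb0, b.repr_self]
  have rα : b.repr α = Finsupp.single 1 1 := by rw [← hb1, b.repr_self]
  have rα2 : b.repr (α * α) = t • Finsupp.single 0 1 + s • Finsupp.single 1 1 := by
    rw [← pow_two, hst, ← r1, ← rα, ← map_zsmul, ← map_zsmul, ← map_add]; simp
  have trα : Algebra.trace ℤ (𝓞 K) α = s := by
    rw [Algebra.trace_eq_matrix_trace b, Matrix.trace, Fin.sum_univ_two]
    simp [Algebra.leftMulMatrix_eq_repr_mul, hb0, hb1, rα, rα2]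
  have tr1 : Algebra.trace ℤ (𝓞 K) 1 = 2 := by
    rw [Algebra.trace_eq_matrix_trace b, map_one, Matrix.trace_one]; simp
  have trα2 : Algebra.trace ℤ (𝓞 K) (α * α) = s ^ 2 + 2 * t := by
    have : α * α = s • α + t • 1 := by rw [← pow_two, hst]; simp; ring
    rw [this, map_add, map_zsmul, map_zsmul, trα, tr1]; simp; ring
  -- The trace form has matrix `[[2, s], [s, s² + 2t]]`.
  rw [← discr_eq_discr K b, Algebra.discr_def, Matrix.det_fin_two]
  simp [Algebra.traceMatrix_apply, Algebra.traceForm_apply, hb0, hb1, trα, tr1, trα2]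
  ring

open NumberField in
/-- The discriminant of a quadratic field is a fundamental discriminant. -/
theorem discr_quadratic_fundamental (K : Type*) [Field K] [NumberField K]
    (hK : Module.finrank ℚ K = 2) :
    (discr K % 4 = 0 ∨ discr K % 4 = 1) ∧
      ∀ f e : ℤ, discr K = f ^ 2 * e → (e % 4 = 0 ∨ e % 4 = 1) → IsUnit f := by
  obtain ⟨α, s, t, hα, hspan, hind, hd⟩ := exists_generator_discr_eq K hK
  constructor
  · rw [hd]
    rcases Int.even_or_odd' s with ⟨k, rfl | rfl⟩
    · left; ring_nf; omega
    · right; ring_nf; omega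
  · intro f e hfe he
    have hf : f ≠ 0 := by
      rintro rfl
      exact discr_ne_zero K (by simpa using hfe)
    have hαK : (α : K) ^ 2 = s * α + t := by
      simpa using congrArg (algebraMap (𝓞 K) K) hα
    obtain ⟨c, hc⟩ : ∃ c : ℤ, e ^ 2 - e = 4 * c := by
      refine ⟨(e ^ 2 - e) / 4, (Int.mul_ediv_cancel' ?_).symm⟩
      rcases he with he | he
      · obtain ⟨k, rfl⟩ : ∃ k, e = 4 * k := ⟨e / 4, by omega⟩
        exact ⟨4 * k ^ 2 - k, by ring⟩
      · obtain ⟨k, rfl⟩ : ∃ k, e = 4 * k + 1 := ⟨e / 4, by omega⟩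
        exact ⟨4 * k ^ 2 + k, by ring⟩
    have hfK : (f : K) ≠ 0 := by exact_mod_cast hf
    -- `(2α - s) / f` is a square root of `e`, so `β = (e + √e)/2` is a root of `X² - eX + (e² -
    -- e)/4`, which is integral as `e ≡ 0, 1` mod 4. Writing `β` in the basis `1, α` and comparing
    -- coefficients of `α` gives `f * b = 1`.
    set β : K := (e + (2 * α - s) / f) / 2 with hβ
    have hβ2 : 2 * f * β = f * e + (2 * α - s) := by rw [hβ]; field_simp
    have hγ : (2 * (α : K) - s) ^ 2 = f ^ 2 * e := by
      have h1 : ((s : K) ^ 2 + 4 * t) = f ^ 2 * e := by exact_mod_cast (hd.symm.trans hfe)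
      rw [← h1]; linear_combination 4 * hαK
    have hcK : (e : K) ^ 2 - e = 4 * c := by exact_mod_cast hc
    have hroot : β ^ 2 - e * β + c = 0 := by
      have h4 : (4 * f ^ 2 : K) * (β ^ 2 - e * β + c) = 0 := by
        linear_combination (2 * f * β + f * e + (2 * α - s) - 2 * f * e) * hβ2 + hγ
          - f ^ 2 * hcK
      rcases mul_eq_zero.1 h4 with h | h
      · exact absurd h (by simp [hfK])
      · exact h
    have hint : IsIntegral ℤ β := by
      refine ⟨Polynomial.X ^ 2 - Polynomial.C e * Polynomial.X + Polynomial.C c, ?_, ?_⟩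
      · monicity!
      · simp only [Polynomial.eval₂_add, Polynomial.eval₂_sub, Polynomial.eval₂_mul,
          Polynomial.eval₂_pow, Polynomial.eval₂_X, Polynomial.eval₂_C]
        simpa using hroot
    obtain ⟨a, b, hab⟩ := hspan ⟨β, hint⟩
    have habK : β = a + b * (α : K) := by
      have h := congrArg (algebraMap (𝓞 K) K) hab
      rwa [map_add, map_mul, map_intCast, map_intCast] at h
    have h3 : ((2 * f * a - f * e + s : ℤ) : 𝓞 K) + ((2 * f * b - 2 : ℤ) : 𝓞 K) * α = 0 := by
      apply RingOfIntegers.ext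
      rw [habK] at hβ2
      simp only [map_add, map_mul, map_intCast, map_zero]
      push_cast
      linear_combination hβ2
    have := (hind _ _ h3).2
    exact IsUnit.of_mul_eq_one b (by linarith)

/-! ### The Kronecker symbol of a fundamental discriminant. -/

namespace EvenCharElliptic

theorem kroneckerSymbol_two_pow_mul (a : ℕ) (k n : ℕ) (hn : Odd n) :
    kroneckerSymbol a ((2 ^ k * n : ℕ) : ℤ) = ZMod.χ₈ (a : ZMod 8) ^ k * J((a : ℤ) | n) := by
  have hn0 : n ≠ 0 := by rintro rfl; simp at hn
  have hv : padicValNat 2 (2 ^ k * n) = k := by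
    rw [padicValNat.mul (by positivity) hn0, padicValNat.prime_pow,
      padicValNat.eq_zero_of_not_dvd hn.not_two_dvd_nat, add_zero]
  have h0 : ((2 ^ k * n : ℕ) : ℤ) ≠ 0 := by positivity
  have hs : ¬ (((2 ^ k * n : ℕ) : ℤ) < 0 ∧ (a : ℤ) < 0) := by rintro ⟨h, -⟩; omega
  rw [kroneckerSymbol, if_neg h0, if_neg hs, Int.natAbs_natCast, hv,
    Nat.mul_div_cancel_left _ (by positivity), one_mul, Int.cast_natCast]

theorem kroneckerSymbol_odd (a : ℕ) {n : ℕ} (hn : Odd n) :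
    kroneckerSymbol a (n : ℤ) = J((a : ℤ) | n) := by
  simpa using kroneckerSymbol_two_pow_mul a 0 n hn

theorem kroneckerSymbol_zero {a : ℕ} (ha : a ≠ 1) : kroneckerSymbol a 0 = 0 := by
  simp [kroneckerSymbol, ha]

theorem kroneckerSymbol_even_even {a n : ℕ} (ha : Even a) (hn : Even n) :
    kroneckerSymbol a (n : ℤ) = 0 := by
  rcases eq_or_ne n 0 with rfl | hn0
  · exact kroneckerSymbol_zero (by rintro rfl; simp at ha)
  obtain ⟨k, m, hm, rfl⟩ := Nat.exists_eq_two_pow_mul_odd hn0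
  have hk : k ≠ 0 := by
    rintro rfl
    rw [pow_zero, one_mul] at hn
    exact (Nat.not_even_iff_odd.2 hm) hn
  have h8 : ZMod.χ₈ (a : ZMod 8) = 0 := by
    rw [ZMod.χ₈_nat_eq_if_mod_eight, if_pos (Nat.even_iff.1 ha)]
  rw [kroneckerSymbol_two_pow_mul _ _ _ hm, h8, zero_pow hk, zero_mul]

/-- Reciprocity for the odd part of `n` carries no sign since `a ≡ 1` mod 4; powers of 2 match
because `χ₈(a) = (2/a)`. -/
theorem kroneckerSymbol_one_mod_four {a : ℕ} (ha : a % 4 = 1) (ha1 : a ≠ 1) (n : ℕ) :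
    kroneckerSymbol a (n : ℤ) = J((n : ℤ) | a) := by
  have hodd : Odd a := Nat.odd_iff.2 (by omega)
  rcases eq_or_ne n 0 with rfl | hn0
  · rw [Nat.cast_zero, kroneckerSymbol_zero ha1, jacobiSym.zero_left (by omega)]
  obtain ⟨k, m, hm, rfl⟩ := Nat.exists_eq_two_pow_mul_odd hn0
  rw [kroneckerSymbol_two_pow_mul _ _ _ hm, ← jacobiSym.at_two hodd,
    jacobiSym.quadratic_reciprocity_one_mod_four ha hm, ← jacobiSym.pow_left,
    ← jacobiSym.mul_left]
  push_cast; rfl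

/-- The symbol `n ↦ φ(n) (n/m)` attached to a quadratic character `φ` modulo `e`. -/
def twistedJacobi {e : ℕ} (φ : MulChar (ZMod e) ℤ) (m : ℕ) (n : ℤ) : ℤ := φ n * J(n | m)

/-- `n ↦ φ(n) (n/m)` agrees with the Kronecker symbol `(d/n)`, where `d = e m` is a fundamental
discriminant, `φ` is a quadratic character modulo `e ∈ {1, 4, 8}` and `m` is odd. -/
structure IsKroneckerFactorization (d e m : ℕ) (φ : MulChar (ZMod e) ℤ) : Prop where
  eq_mul : d = e * m
  one_lt : 1 < d
  squarefree : Squarefree m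
  odd : Odd m
  coprime : e.Coprime m
  isQuadratic : φ.IsQuadratic
  even : twistedJacobi φ m (-1) = 1
  kronecker : ∀ n : ℕ, kroneckerSymbol d n = twistedJacobi φ m n
  -- The element `1 + d/2` witnesses that the symbol has no period `d/2`; this is needed for
  -- primitivity at 2.
  two : ∀ p : ℕ, p.Prime → p ∣ e → p = 2 ∧ φ ((1 + d / 2 : ℕ) : ℤ) = -1

theorem chi_four_mul_jacobi {m n : ℕ} (hm : m % 4 = 3) (hn : Odd n) :
    J((m : ℤ) | n) = ZMod.χ₄ (n : ℤ) * J((n : ℤ) | m) := by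
  have hmo : Odd m := Nat.odd_iff.2 (by omega)
  have h2 := Nat.odd_iff.1 hn
  rcases (by omega : n % 4 = 1 ∨ n % 4 = 3) with h | h
  · rw [ZMod.χ₄_int_one_mod_four (by omega), one_mul,
      jacobiSym.quadratic_reciprocity_one_mod_four' hmo h]
  · rw [ZMod.χ₄_int_three_mod_four (by omega), neg_one_mul,
      jacobiSym.quadratic_reciprocity_three_mod_four hm h]

theorem isKroneckerFactorization_one {m : ℕ} (hm : m % 4 = 1) (h1 : 1 < m) (hs : Squarefree m) :
    IsKroneckerFactorization m 1 m (1 : MulChar (ZMod 1) ℤ) where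
  eq_mul := (one_mul m).symm
  one_lt := h1
  squarefree := hs
  odd := Nat.odd_iff.2 (by omega)
  coprime := Nat.coprime_one_left m
  isQuadratic := fun a => by
    right; left; exact MulChar.one_apply (isUnit_of_subsingleton a)
  even := by
    rw [twistedJacobi, MulChar.one_apply (isUnit_of_subsingleton _), one_mul,
      jacobiSym.at_neg_one (Nat.odd_iff.2 (by omega)), ZMod.χ₄_nat_one_mod_four hm]
  kronecker := fun n => by
    rw [twistedJacobi, MulChar.one_apply (isUnit_of_subsingleton _), one_mul,
      kroneckerSymbol_one_mod_four hm (by omega)]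
  two := fun p hp hpe => absurd (Nat.dvd_one.1 hpe) hp.ne_one

theorem jacobiSym_four_mul (m : ℕ) {n : ℕ} (hn : Odd n) :
    J(((4 * m : ℕ) : ℤ) | n) = J((m : ℤ) | n) := by
  push_cast
  rw [jacobiSym.mul_left, jacobiSym.at_four hn, one_mul]

/-- The reciprocity sign is `χ₄(n)`. Evenness holds because `χ₄` and `(·/m)` are both odd when `m ≡
3` mod 4. -/
theorem isKroneckerFactorization_four {m : ℕ} (hm : m % 4 = 3) (hs : Squarefree m) :
    IsKroneckerFactorization (4 * m) 4 m ZMod.χ₄ where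
  eq_mul := rfl
  one_lt := by omega
  squarefree := hs
  odd := Nat.odd_iff.2 (by omega)
  coprime := (Nat.coprime_pow_left_iff two_pos 2 m).2
    ((Nat.coprime_two_left).2 (Nat.odd_iff.2 (by omega)))
  isQuadratic := ZMod.isQuadratic_χ₄
  even := by
    rw [twistedJacobi, jacobiSym.at_neg_one (Nat.odd_iff.2 (by omega)),
      ZMod.χ₄_nat_three_mod_four hm]
    decide
  kronecker := fun n => by
    rcases Nat.even_or_odd n with hn | hn
    · rw [kroneckerSymbol_even_even ⟨2 * m, by ring⟩ hn, twistedJacobi, ZMod.χ₄_int_eq_if_mod_four,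
        if_pos (by have := Nat.even_iff.1 hn; omega), zero_mul]
    · rw [kroneckerSymbol_odd _ hn, jacobiSym_four_mul m hn, chi_four_mul_jacobi hm hn,
        twistedJacobi]
  two := fun p hp hpe => by
    refine ⟨(Nat.prime_dvd_prime_iff_eq hp Nat.prime_two).1
      (hp.dvd_of_dvd_pow (show p ∣ 2 ^ 2 from hpe)), ?_⟩
    exact ZMod.χ₄_int_three_mod_four (by omega)

theorem jacobiSym_eight_mul (m : ℕ) {n : ℕ} (hn : Odd n) :
    J(((8 * m : ℕ) : ℤ) | n) = ZMod.χ₈ (n : ℤ) * J((m : ℤ) | n) := by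
  rw [show 8 * m = 4 * (2 * m) by ring, jacobiSym_four_mul _ hn]
  push_cast
  rw [jacobiSym.mul_left, jacobiSym.at_two hn]

theorem isKroneckerFactorization_eight {m : ℕ} (hm : m % 4 = 1) (hs : Squarefree m) :
    IsKroneckerFactorization (8 * m) 8 m ZMod.χ₈ where
  eq_mul := rfl
  one_lt := by omega
  squarefree := hs
  odd := Nat.odd_iff.2 (by omega)
  coprime := (Nat.coprime_pow_left_iff three_pos 2 m).2
    ((Nat.coprime_two_left).2 (Nat.odd_iff.2 (by omega)))
  isQuadratic := ZMod.isQuadratic_χ₈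
  even := by
    rw [twistedJacobi, jacobiSym.at_neg_one (Nat.odd_iff.2 (by omega)),
      ZMod.χ₄_nat_one_mod_four hm]
    decide
  kronecker := fun n => by
    rcases Nat.even_or_odd n with hn | hn
    · rw [kroneckerSymbol_even_even ⟨4 * m, by ring⟩ hn, twistedJacobi, ZMod.χ₈_int_eq_if_mod_eight,
        if_pos (by have := Nat.even_iff.1 hn; omega), zero_mul]
    · rw [kroneckerSymbol_odd _ hn, jacobiSym_eight_mul m hn,
        jacobiSym.quadratic_reciprocity_one_mod_four hm hn, twistedJacobi]
  two := fun p hp hpe => by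
    refine ⟨(Nat.prime_dvd_prime_iff_eq hp Nat.prime_two).1
      (hp.dvd_of_dvd_pow (show p ∣ 2 ^ 3 from hpe)), ?_⟩
    -- As `m` is odd, `1 + d/2 = 1 + 4m ≡ 5` mod 8.
    rw [ZMod.χ₈_int_eq_if_mod_eight, if_neg (by omega), if_neg (by omega)]

theorem isKroneckerFactorization_eight' {m : ℕ} (hm : m % 4 = 3) (hs : Squarefree m) :
    IsKroneckerFactorization (8 * m) 8 m ZMod.χ₈' where
  eq_mul := rfl
  one_lt := by omega
  squarefree := hs
  odd := Nat.odd_iff.2 (by omega)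
  coprime := (Nat.coprime_pow_left_iff three_pos 2 m).2
    ((Nat.coprime_two_left).2 (Nat.odd_iff.2 (by omega)))
  isQuadratic := ZMod.isQuadratic_χ₈'
  even := by
    rw [twistedJacobi, jacobiSym.at_neg_one (Nat.odd_iff.2 (by omega)),
      ZMod.χ₄_nat_three_mod_four hm]
    decide
  kronecker := fun n => by
    rcases Nat.even_or_odd n with hn | hn
    · rw [kroneckerSymbol_even_even ⟨4 * m, by ring⟩ hn, twistedJacobi,
        ZMod.χ₈'_int_eq_if_mod_eight, if_pos (by have := Nat.even_iff.1 hn; omega), zero_mul]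
    · rw [kroneckerSymbol_odd _ hn, jacobiSym_eight_mul m hn, chi_four_mul_jacobi hm hn,
        twistedJacobi, ZMod.χ₈'_int_eq_χ₄_mul_χ₈]
      ring
  two := fun p hp hpe => by
    refine ⟨(Nat.prime_dvd_prime_iff_eq hp Nat.prime_two).1
      (hp.dvd_of_dvd_pow (show p ∣ 2 ^ 3 from hpe)), ?_⟩
    rw [ZMod.χ₈'_int_eq_if_mod_eight, if_neg (by omega), if_neg (by omega)]

/-- Every positive fundamental discriminant has a Kronecker factorization. -/
theorem exists_isKroneckerFactorization {d : ℕ} (h1 : 1 < d) (h4 : d % 4 = 0 ∨ d % 4 = 1)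
    (hf : ∀ f e : ℕ, d = f ^ 2 * e → (e % 4 = 0 ∨ e % 4 = 1) → f = 1) :
    ∃ (e m : ℕ) (φ : MulChar (ZMod e) ℤ), IsKroneckerFactorization d e m φ := by
  -- If an odd `p²` divides `d`, then `p² ≡ 1` mod 4 and `d/p²` has the same residue mod 4 as `d`,
  -- against fundamentality.
  have hsq : ∀ c m : ℕ, d = c * m → Odd m → Squarefree m := by
    intro c m hd hm
    rw [Nat.squarefree_iff_prime_squarefree]
    rintro p hp ⟨k, rfl⟩
    have hpo : Odd p := (Nat.odd_mul.1 (Nat.odd_mul.1 hm).1).1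
    refine hp.ne_one (hf p (c * k) (by rw [hd]; ring) ?_)
    have hp8 : p * p % 4 = 1 := by
      have := Nat.odd_iff.1 hpo
      rcases (by omega : p % 4 = 1 ∨ p % 4 = 3) with h | h <;> simp [Nat.mul_mod, h]
    have : d % 4 = c * k % 4 := by
      rw [hd, show c * (p * p * k) = (p * p) * (c * k) by ring, Nat.mul_mod, hp8, one_mul,
        Nat.mod_mod]
    omega
  rcases h4 with h4 | h4
  · obtain ⟨n, rfl⟩ : ∃ n, d = 4 * n := ⟨d / 4, by omega⟩
    have hn : ¬ (n % 4 = 0 ∨ n % 4 = 1) := fun h => by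
      have := hf 2 n (by ring) h
      omega
    rcases (by omega : n % 4 = 3 ∨ n % 4 = 2) with h | h
    · exact ⟨4, n, _, isKroneckerFactorization_four h (hsq 4 n rfl (Nat.odd_iff.2 (by omega)))⟩
    · obtain ⟨m, rfl⟩ : ∃ m, n = 2 * m := ⟨n / 2, by omega⟩
      have hs : Squarefree m := hsq 8 m (by ring) (Nat.odd_iff.2 (by omega))
      rw [show 4 * (2 * m) = 8 * m by ring]
      rcases (by omega : m % 4 = 1 ∨ m % 4 = 3) with h | h
      · exact ⟨8, m, _, isKroneckerFactorization_eight h hs⟩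
      · exact ⟨8, m, _, isKroneckerFactorization_eight' h hs⟩
  · exact ⟨1, d, _, isKroneckerFactorization_one h4 h1
      (hsq 1 d (one_mul d).symm (Nat.odd_iff.2 (by omega)))⟩

end EvenCharElliptic

/-! ### The Kronecker symbol as a primitive Dirichlet character. -/

namespace EvenCharElliptic

namespace IsKroneckerFactorization

variable {d e m : ℕ} {φ : MulChar (ZMod e) ℤ}

theorem twistedJacobi_mul (a b : ℤ) :
    twistedJacobi φ m (a * b) = twistedJacobi φ m a * twistedJacobi φ m b := by
  simp only [twistedJacobi, Int.cast_mul, map_mul, jacobiSym.mul_left]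
  ring

theorem twistedJacobi_one : twistedJacobi φ m 1 = 1 := by
  simp [twistedJacobi, jacobiSym.one_left]

theorem ne_zero (h : IsKroneckerFactorization d e m φ) : d ≠ 0 := by
  have := h.one_lt; omega

theorem twistedJacobi_congr (h : IsKroneckerFactorization d e m φ) {a b : ℤ}
    (hab : a ≡ b [ZMOD d]) : twistedJacobi φ m a = twistedJacobi φ m b := by
  rw [h.eq_mul] at hab
  push_cast at hab
  have h1 : ((a : ℤ) : ZMod e) = b := (ZMod.intCast_eq_intCast_iff _ _ _).2 hab.of_mul_right
  have h2 : J(a | m) = J(b | m) := jacobiSym.mod_left' hab.of_mul_left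
  rw [twistedJacobi, twistedJacobi, h1, h2]

theorem twistedJacobi_eq_zero (h : IsKroneckerFactorization d e m φ) {a : ℤ}
    (ha : ¬ IsCoprime (d : ℤ) a) : twistedJacobi φ m a = 0 := by
  have hm : m ≠ 0 := by rintro rfl; exact h.ne_zero (by simp [h.eq_mul])
  rw [h.eq_mul] at ha
  push_cast at ha
  rw [IsCoprime.mul_left_iff, not_and_or] at ha
  rcases ha with ha | ha
  · rw [twistedJacobi, MulChar.map_nonunit, zero_mul]
    rwa [ZMod.coe_int_isUnit_iff_isCoprime]
  · rw [twistedJacobi, jacobiSym.eq_zero_iff.2 ⟨hm, fun h => ha ?_⟩, mul_zero]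
    exact (Int.isCoprime_iff_gcd_eq_one.2 h).symm

theorem twistedJacobi_sq (h : IsKroneckerFactorization d e m φ) {a : ℤ}
    (ha : IsCoprime (d : ℤ) a) : twistedJacobi φ m a ^ 2 = 1 := by
  rw [h.eq_mul] at ha
  push_cast at ha
  rw [IsCoprime.mul_left_iff] at ha
  have h1 : φ (a : ZMod e) ^ 2 = 1 := by
    rw [← MulChar.pow_apply' φ two_ne_zero, h.isQuadratic.sq_eq_one,
      MulChar.one_apply ((ZMod.coe_int_isUnit_iff_isCoprime a e).2 ha.1)]
  rw [twistedJacobi, mul_pow, h1, jacobiSym.sq_one (Int.isCoprime_iff_gcd_eq_one.1 ha.2.symm),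
    one_mul]

/-- A Kronecker symbol with fundamental positive upper entry is a Dirichlet character. -/
theorem exists_dirichletCharacter (h : IsKroneckerFactorization d e m φ) :
    ∃ ψ : DirichletCharacter ℂ d, ∀ n : ℤ, ψ n = (twistedJacobi φ m n : ℂ) := by
  have : NeZero d := ⟨h.ne_zero⟩
  have hval : ∀ n : ℤ, twistedJacobi φ m ((n : ZMod d).val : ℤ) = twistedJacobi φ m n := fun n =>
    h.twistedJacobi_congr ((ZMod.intCast_eq_intCast_iff _ _ _).1 (by simp))
  have hmul : ∀ a b : ZMod d, twistedJacobi φ m ((a * b).val : ℤ) =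
      twistedJacobi φ m (a.val : ℤ) * twistedJacobi φ m (b.val : ℤ) := fun a b => by
    rw [← twistedJacobi_mul]
    exact h.twistedJacobi_congr ((ZMod.intCast_eq_intCast_iff _ _ _).1 (by simp))
  refine ⟨{ toFun := fun a => (twistedJacobi φ m (a.val : ℤ) : ℂ)
            map_one' := ?_
            map_mul' := fun a b => by rw [hmul]; push_cast; rfl
            map_nonunit' := fun a ha => ?_ }, fun n => ?_⟩
  · have := hval 1
    rw [twistedJacobi_one, Int.cast_one] at this
    exact_mod_cast this
  · rw [h.twistedJacobi_eq_zero, Int.cast_zero]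
    rw [← ZMod.coe_int_isUnit_iff_isCoprime]
    simpa using ha
  · change ((twistedJacobi φ m ((n : ZMod d).val : ℤ) : ℤ) : ℂ) = _
    rw [hval]

/-- These witnesses exclude every period `d/p`. For `p ∣ e` the field `two` provides one; for `p ∣
m` the Chinese remainder theorem combines a nonresidue mod `p` with `1` mod `d/p`, the two moduli
being coprime as `m` is squarefree. -/
theorem exists_twistedJacobi_eq_neg_one (h : IsKroneckerFactorization d e m φ) {p : ℕ}
    (hp : p.Prime) (hpd : p ∣ d) :
    ∃ u : ℤ, u ≡ 1 [ZMOD (d / p : ℕ)] ∧ twistedJacobi φ m u = -1 := by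
  by_cases hpe : p ∣ e
  · obtain ⟨rfl, h2⟩ := h.two p hp hpe
    refine ⟨((1 + d / 2 : ℕ) : ℤ), ?_, ?_⟩
    · push_cast
      exact Int.modEq_iff_dvd.2 ⟨-1, by ring⟩
    · obtain ⟨k, rfl⟩ := hpe
      have hk : d / 2 = k * m := by rw [h.eq_mul, mul_assoc, Nat.mul_div_cancel_left _ two_pos]
      have hJ : J(((1 + d / 2 : ℕ) : ℤ) | m) = 1 := by
        rw [jacobiSym.mod_left' (a₂ := 1), jacobiSym.one_left]
        rw [hk]; push_cast; simp
      rw [twistedJacobi, h2, hJ, mul_one]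
  · have hpm : p ∣ m := ((Nat.Prime.dvd_mul hp).1 (h.eq_mul ▸ hpd)).resolve_left hpe
    obtain ⟨k, rfl⟩ := hpm
    have : Fact p.Prime := ⟨hp⟩
    have hpk : Nat.Coprime p k := (Nat.squarefree_mul_iff.1 h.squarefree).1
    have hk0 : k ≠ 0 := by rintro rfl; exact h.ne_zero (by simp [h.eq_mul])
    have hp2 : p ≠ 2 := by
      rintro rfl
      exact (Nat.odd_mul.1 h.odd).1.not_two_dvd_nat dvd_rfl
    obtain ⟨a, ha⟩ := quadraticChar_exists_neg_one (F := ZMod p) (by rwa [ZMod.ringChar_zmod_n])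
    have hco : Nat.Coprime (e * k) p :=
      Nat.Coprime.mul_left ((Nat.Prime.coprime_iff_not_dvd hp).2 hpe).symm hpk.symm
    obtain ⟨u, hu1, hu2⟩ := Nat.chineseRemainder hco 1 a.val
    have hdp : d / p = e * k := by
      rw [h.eq_mul, show e * (p * k) = p * (e * k) by ring, Nat.mul_div_cancel_left _ hp.pos]
    refine ⟨u, ?_, ?_⟩
    · rw [hdp]
      exact_mod_cast (Int.natCast_modEq_iff.2 hu1)
    · have e1 : ((u : ℤ) : ZMod e) = 1 := by
        have := (ZMod.natCast_eq_natCast_iff _ _ _).2 (hu1.of_mul_right k)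
        simpa using this
      have e2 : J((u : ℤ) | k) = 1 := by
        rw [jacobiSym.mod_left' (a₂ := 1), jacobiSym.one_left]
        exact_mod_cast (hu1.of_mul_left e)
      have e3 : J((u : ℤ) | p) = -1 := by
        rw [← jacobiSym.legendreSym.to_jacobiSym, legendreSym]
        have : ((u : ℤ) : ZMod p) = a := by
          have := (ZMod.natCast_eq_natCast_iff _ _ _).2 hu2
          simpa using this
        rw [this, ha]
      rw [twistedJacobi, e1, map_one, jacobiSym.mul_right' _ hp.ne_zero hk0, e2, e3]
      norm_num

/-- A conductor smaller than `d` would divide `d/p` for some prime `p`, forcing the value `1` at the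
witness where it is `-1`. -/
theorem isPrimitive (h : IsKroneckerFactorization d e m φ) {ψ : DirichletCharacter ℂ d}
    (hψ : ∀ n : ℤ, ψ n = (twistedJacobi φ m n : ℂ)) : ψ.IsPrimitive := by
  have : NeZero d := ⟨h.ne_zero⟩
  by_contra hne
  obtain ⟨k, hk⟩ := ψ.conductor_dvd_level
  have hk1 : k ≠ 1 := by
    rintro rfl
    exact hne (by rw [DirichletCharacter.isPrimitive_def]; omega)
  obtain ⟨p, hp, j, rfl⟩ := Nat.exists_prime_and_dvd hk1
  have hpd : p ∣ d := ⟨ψ.conductor * j, by linarith⟩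
  have hdp : d / p = ψ.conductor * j := by
    rw [Nat.div_eq_iff_eq_mul_left hp.pos hpd]
    linarith
  obtain ⟨hdvd, χ₀, hχ⟩ := DirichletCharacter.FactorsThrough.mono _
    ψ.factorsThrough_conductor (Dvd.intro j hdp.symm) (Nat.div_dvd_of_dvd hpd)
  obtain ⟨u, hu, hu'⟩ := h.exists_twistedJacobi_eq_neg_one hp hpd
  have hcop : IsUnit (u : ZMod d) := by
    rw [ZMod.coe_int_isUnit_iff_isCoprime]
    by_contra hcon
    rw [h.twistedJacobi_eq_zero hcon] at hu'
    norm_num at hu'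
  have h1 : ψ (u : ZMod d) = -1 := by rw [hψ, hu']; simp
  have h2 : ψ (u : ZMod d) = 1 := by
    rw [hχ, ← hcop.unit_spec, DirichletCharacter.changeLevel_eq_cast_of_dvd, hcop.unit_spec,
      ZMod.cast_intCast hdvd, (ZMod.intCast_eq_intCast_iff _ _ _).2 hu, Int.cast_one, map_one]
  rw [h1] at h2
  norm_num at h2

end IsKroneckerFactorization

/-- For a positive fundamental discriminant `d`, the Kronecker symbol `(d/·)` is a real primitive
even Dirichlet character modulo `d`. -/
theorem exists_primitive_chi {d : ℕ} (h1 : 1 < d) (h4 : d % 4 = 0 ∨ d % 4 = 1)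
    (hf : ∀ f e : ℕ, d = f ^ 2 * e → (e % 4 = 0 ∨ e % 4 = 1) → f = 1) :
    ∃ ψ : DirichletCharacter ℂ d, (∀ n : ℕ, ψ n = chi d n) ∧ ψ.IsPrimitive ∧ ψ.Even ∧
      ψ ^ 2 = 1 := by
  obtain ⟨e, m, φ, h⟩ := exists_isKroneckerFactorization h1 h4 hf
  obtain ⟨ψ, hψ⟩ := h.exists_dirichletCharacter
  refine ⟨ψ, fun n => ?_, h.isPrimitive hψ, ?_, ?_⟩
  · rw [chi, h.kronecker, ← hψ, Int.cast_natCast]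
  · have := hψ (-1)
    rw [h.even] at this
    simpa [DirichletCharacter.Even] using this
  · ext a
    obtain ⟨n, hn⟩ := ZMod.intCast_surjective (a : ZMod d)
    have hc : IsCoprime (d : ℤ) n := by
      rw [← ZMod.coe_int_isUnit_iff_isCoprime, hn]; exact a.isUnit
    rw [MulChar.pow_apply_coe, MulChar.one_apply_coe, ← hn, hψ]
    exact_mod_cast h.twistedJacobi_sq hc

end EvenCharElliptic

/-! ### Theta at rational points and Landsberg–Schaar reciprocity. -/

theorem HasSum.of_eq {ι M : Type*} [AddCommMonoid M] [TopologicalSpace M] {f g : ι → M} {a : M}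
    (h : HasSum f a) (e : ∀ i, g i = f i) : HasSum g a := funext e ▸ h

/-- A sum over `n < N` of a function of `n` modulo `N` is a sum over `ZMod N`. -/
theorem sum_range_eq_sum_zmod {M : Type*} [AddCommMonoid M] (N : ℕ) [NeZero N] (f : ZMod N → M) :
    ∑ n ∈ Finset.range N, f (n : ZMod N) = ∑ a : ZMod N, f a := by
  refine Finset.sum_nbij' (fun n => (n : ZMod N)) ZMod.val (fun _ _ => Finset.mem_univ _)
    (fun a _ => Finset.mem_range.2 a.val_lt) (fun n hn => ?_) (fun a _ => ?_) (fun _ _ => rfl)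
  · exact ZMod.val_cast_of_lt (Finset.mem_range.1 hn)
  · exact ZMod.natCast_zmod_val a

/-- Only the term `n = 0` survives. For real `x` the other terms have norm `exp(-π n² Im τ)`,
dominated by the series at `τ = I`. -/
theorem tendsto_jacobiTheta₂_ofReal {ι : Type*} {l : Filter ι} (x : ℝ) {τ : ι → ℂ}
    (hτ : Tendsto (fun i => (τ i).im) l atTop) :
    Tendsto (fun i => jacobiTheta₂ x (τ i)) l (𝓝 1) := by
  have hnorm : ∀ (n : ℤ) (w : ℂ), ‖jacobiTheta₂_term n x w‖ = Real.exp (-Real.pi * n ^ 2 * w.im) :=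
    fun n w => by simp [norm_jacobiTheta₂_term]
  have key : Tendsto (fun i => ∑' n : ℤ, jacobiTheta₂_term n x (τ i)) l
      (𝓝 (∑' n : ℤ, if n = 0 then (1 : ℂ) else 0)) := by
    refine tendsto_tsum_of_dominated_convergence
      (bound := fun n : ℤ => ‖jacobiTheta₂_term n x Complex.I‖) ?_ ?_ ?_
    · exact ((summable_jacobiTheta₂_term_iff _ _).2 (by simp)).norm
    · intro n
      rcases eq_or_ne n 0 with rfl | hn
      · simp only [jacobiTheta₂_term, Int.cast_zero, if_pos]
        simpa using tendsto_const_nhds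
      · rw [if_neg hn, tendsto_zero_iff_norm_tendsto_zero]
        simp only [hnorm]
        refine Real.tendsto_exp_atBot.comp ?_
        refine hτ.const_mul_atTop_of_neg ?_
        have : (0 : ℝ) < (n : ℝ) ^ 2 := by positivity
        nlinarith [Real.pi_pos]
    · filter_upwards [hτ.eventually_ge_atTop 1] with i hi n
      rw [hnorm, hnorm, Complex.I_im]
      refine Real.exp_le_exp.2 ?_
      have : 0 ≤ Real.pi * (n : ℝ) ^ 2 := by positivity
      nlinarith
  rw [tsum_ite_eq] at key
  exact key

theorem ofReal_mul_cpow {a : ℝ} (ha : 0 < a) {z : ℂ} (hz : z ≠ 0) (s : ℂ) :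
    ((a : ℂ) * z) ^ s = (a : ℂ) ^ s * z ^ s := by
  have ha' : (a : ℂ) ≠ 0 := Complex.ofReal_ne_zero.2 ha.ne'
  rw [Complex.cpow_def_of_ne_zero (mul_ne_zero ha' hz), Complex.cpow_def_of_ne_zero ha',
    Complex.cpow_def_of_ne_zero hz, Complex.log_ofReal_mul ha hz, ← Complex.exp_add,
    Complex.ofReal_log ha.le]
  ring_nf

/-- Poisson summation for a Gaussian on an arithmetic progression. -/
theorem hasSum_gaussian_arith_progression (N : ℕ) [NeZero N] (r : ℕ) {ε : ℂ} (hε : 0 < ε.re) :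
    HasSum (fun k : ℤ => Complex.exp (-Real.pi * (r + N * k) ^ 2 * ε))
      (1 / (N * ε ^ (1 / 2 : ℂ)) *
        jacobiTheta₂ ((-(r : ℝ) / N : ℝ) : ℂ) (Complex.I / (N ^ 2 * ε))) := by
  have hN : (N : ℂ) ≠ 0 := Nat.cast_ne_zero.2 (NeZero.ne N)
  have hε0 : ε ≠ 0 := by rintro rfl; simp at hε
  have hI := Complex.I_ne_zero
  have him : 0 < (Complex.I * N ^ 2 * ε).im := by
    have h : (Complex.I * N ^ 2 * ε) = Complex.I * ((N ^ 2 : ℝ) * ε) := by push_cast; ring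
    have hNR : (0 : ℝ) < (N : ℝ) ^ 2 := by
      have := NeZero.pos N
      positivity
    rw [h, Complex.I_mul_im, Complex.re_ofReal_mul]
    positivity
  have h1 := (hasSum_jacobiTheta₂_term (Complex.I * r * N * ε) him).mul_left
    (Complex.exp (-Real.pi * r ^ 2 * ε))
  have hsq : (1 / (N ^ 2 * ε)) ^ (1 / 2 : ℂ) = 1 / (N * ε ^ (1 / 2 : ℂ)) := by
    have harg : ε.arg ≠ Real.pi := fun h => by
      have := (Complex.abs_arg_lt_pi_div_two_iff.2 (Or.inl hε))
      rw [h, abs_of_pos Real.pi_pos] at this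
      linarith [Real.pi_pos]
    have e1 : 1 / ((N : ℂ) ^ 2 * ε) = (((1 / (N : ℝ)) ^ 2 : ℝ) : ℂ) * ε⁻¹ := by
      push_cast; field_simp
    have e2 : ((((1 / (N : ℝ)) ^ 2 : ℝ) : ℂ)) ^ (1 / 2 : ℂ) = 1 / N := by
      rw [show (1 / 2 : ℂ) = ((1 / 2 : ℝ) : ℂ) by push_cast; rfl,
        ← Complex.ofReal_cpow (by positivity), ← Real.sqrt_eq_rpow, Real.sqrt_sq (by positivity)]
      push_cast; rfl
    rw [e1, ofReal_mul_cpow (by have := NeZero.pos N; positivity) (inv_ne_zero hε0), e2, Complex.inv_cpow _ _ harg]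
    field_simp
  -- Poisson summation enters as the theta functional equation, at the point whose image under `τ ↦
  -- -1/τ` is `I * N ^ 2 * ε`.
  have hfe := jacobiTheta₂_functional_equation ((-(r : ℝ) / N : ℝ) : ℂ) (Complex.I / (N ^ 2 * ε))
  have a1 : (-Complex.I * (Complex.I / (N ^ 2 * ε))) = 1 / (N ^ 2 * ε) := by
    field_simp; simp
  have a2 : (((-(r : ℝ) / N : ℝ) : ℂ) / (Complex.I / (N ^ 2 * ε))) = Complex.I * r * N * ε := by
    push_cast; field_simp; rw [Complex.I_sq]; ring
  have a3 : -1 / (Complex.I / (N ^ 2 * ε)) = Complex.I * N ^ 2 * ε := by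
    field_simp; rw [Complex.I_sq]
  have a4 : -(Real.pi : ℂ) * Complex.I * (((-(r : ℝ) / N : ℝ) : ℂ)) ^ 2 /
      (Complex.I / (N ^ 2 * ε)) = -Real.pi * r ^ 2 * ε := by
    push_cast; field_simp
  rw [a1, a2, a3, a4, hsq] at hfe
  have hw : ε ^ (1 / 2 : ℂ) ≠ 0 := by
    rw [Complex.cpow_def_of_ne_zero hε0]; exact Complex.exp_ne_zero _
  have hval : 1 / (N * ε ^ (1 / 2 : ℂ)) *
        jacobiTheta₂ ((-(r : ℝ) / N : ℝ) : ℂ) (Complex.I / (N ^ 2 * ε)) =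
      Complex.exp (-Real.pi * r ^ 2 * ε) *
        jacobiTheta₂ (Complex.I * r * N * ε) (Complex.I * N ^ 2 * ε) := by
    rw [hfe]
    generalize ε ^ (1 / 2 : ℂ) = w at hw
    field_simp
  rw [hval]
  refine h1.of_eq fun k => ?_
  rw [jacobiTheta₂_term, ← Complex.exp_add]
  congr 1
  linear_combination (-2 * Real.pi * k * r * N * ε - Real.pi * k ^ 2 * N ^ 2 * ε) * Complex.I_sq

/-- The behaviour of the Jacobi theta function near a rational point of the real axis. -/
theorem tendsto_cpow_mul_jacobiTheta₂ {ι : Type*} {l : Filter ι} (N : ℕ) [NeZero N] (ρ : ℝ)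
    (hρ : ∀ n k : ℤ, Complex.exp (Real.pi * Complex.I * ρ * (n + N * k) ^ 2) =
      Complex.exp (Real.pi * Complex.I * ρ * n ^ 2))
    {ε : ι → ℂ} (hε : ∀ᶠ i in l, 0 < (ε i).re) (hl : Tendsto (fun i => (ε i)⁻¹.re) l atTop) :
    Tendsto (fun i => (ε i) ^ (1 / 2 : ℂ) * jacobiTheta₂ 0 (ρ + Complex.I * ε i)) l
      (𝓝 (1 / N * ∑ r ∈ Finset.range N, Complex.exp (Real.pi * Complex.I * ρ * r ^ 2))) := by
  have hN : (N : ℂ) ≠ 0 := Nat.cast_ne_zero.2 (NeZero.ne N)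
  have hNR : (0 : ℝ) < N := Nat.cast_pos.2 (NeZero.pos N)
  have hformula : ∀ᶠ i in l, ∑ r ∈ Finset.range N, (1 / N : ℂ) *
      (Complex.exp (Real.pi * Complex.I * ρ * r ^ 2) *
        jacobiTheta₂ ((-(r : ℝ) / N : ℝ) : ℂ) (Complex.I / (N ^ 2 * ε i))) =
      (ε i) ^ (1 / 2 : ℂ) * jacobiTheta₂ 0 (ρ + Complex.I * ε i) := by
    filter_upwards [hε] with i hi
    have hε0 : ε i ≠ 0 := by intro h; simp [h] at hi
    have him : 0 < ((ρ : ℂ) + Complex.I * ε i).im := by simpa using hi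
    have h1 := hasSum_jacobiTheta₂_term 0 him
    -- Splitting by residue modulo `N` makes the phase `exp(πiρn²)` constant on each class, leaving
    -- a Gaussian on a progression.
    rw [← (Int.divModEquiv N).symm.hasSum_iff, ← (Equiv.prodComm _ _).hasSum_iff] at h1
    have h2 : ∀ r : Fin N, HasSum (fun k : ℤ => (((fun n => jacobiTheta₂_term n 0
        ((ρ : ℂ) + Complex.I * ε i)) ∘ (Int.divModEquiv N).symm) ∘ (Equiv.prodComm _ _)) (r, k))
        (Complex.exp (Real.pi * Complex.I * ρ * (r : ℕ) ^ 2) *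
          (1 / (N * (ε i) ^ (1 / 2 : ℂ)) *
        jacobiTheta₂ ((-((r : ℕ) : ℝ) / N : ℝ) : ℂ) (Complex.I / (N ^ 2 * ε i)))) := by
      intro r
      refine ((hasSum_gaussian_arith_progression N r hi).mul_left
        (Complex.exp (Real.pi * Complex.I * ρ * (r : ℕ) ^ 2))).of_eq fun k => ?_
      have h3 := hρ (r : ℕ) k
      simp only [Int.cast_natCast] at h3
      simp only [Function.comp_apply, Equiv.prodComm_apply, Prod.swap_prod_mk,
        Int.divModEquiv_symm_apply, jacobiTheta₂_term]
      rw [← h3, ← Complex.exp_add]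
      push_cast
      congr 1
      linear_combination (Real.pi * ((r : ℕ) + N * k) ^ 2 * ε i : ℂ) * Complex.I_sq
    have h4 := (h1.prod_fiberwise h2).unique (hasSum_fintype _)
    have hw : (ε i) ^ (1 / 2 : ℂ) ≠ 0 := by
      rw [Complex.cpow_def_of_ne_zero hε0]; exact Complex.exp_ne_zero _
    rw [jacobiTheta₂, ← jacobiTheta₂, h4, Finset.sum_range, Finset.mul_sum]
    refine Finset.sum_congr rfl fun r _ => ?_
    generalize (ε i) ^ (1 / 2 : ℂ) = w at hw
    field_simp
  refine Tendsto.congr' hformula ?_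
  rw [Finset.mul_sum]
  refine tendsto_finsetSum _ fun r _ => ?_
  refine Tendsto.const_mul _ ?_
  have hlim : Tendsto (fun i => (Complex.I / (N ^ 2 * ε i)).im) l atTop := by
    have e : ∀ i, (Complex.I / (N ^ 2 * ε i)).im = (1 / (N : ℝ) ^ 2) * (ε i)⁻¹.re := fun i => by
      rw [show Complex.I / (N ^ 2 * ε i) = Complex.I * (((1 / (N : ℝ) ^ 2 : ℝ) : ℂ) * (ε i)⁻¹) by
        push_cast; field_simp, Complex.I_mul_im, Complex.re_ofReal_mul]
    simp only [e]
    exact hl.const_mul_atTop (by positivity)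
  have := (tendsto_jacobiTheta₂_ofReal (-(r : ℝ) / N) hlim).const_mul
      (Complex.exp (Real.pi * Complex.I * ρ * r ^ 2))
  rwa [mul_one] at this

theorem Complex.exp_pi_mul_I_mul_even (k : ℤ) (z : ℂ) :
    Complex.exp (z + Real.pi * Complex.I * (2 * k)) = Complex.exp z := by
  rw [show (Real.pi : ℂ) * Complex.I * (2 * k) = k * (2 * Real.pi * Complex.I) by ring,
    Complex.exp_add, Complex.exp_int_mul_two_pi_mul_I, mul_one]

/-- The Landsberg–Schaar reciprocity law for quadratic Gauss sums. -/
theorem landsberg_schaar (p q : ℕ) [NeZero p] [NeZero q] :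
    ∑ n ∈ Finset.range p, Complex.exp (Real.pi * Complex.I * (2 * q / p) * n ^ 2) =
      (((p : ℝ) / (2 * q) : ℝ) * Complex.I) ^ (1 / 2 : ℂ) *
        ∑ x ∈ Finset.range (2 * q), Complex.exp (Real.pi * Complex.I * (-(p / (2 * q))) * x ^ 2) := by
  have hp : (0 : ℝ) < p := Nat.cast_pos.2 (NeZero.pos p)
  have hq : (0 : ℝ) < q := Nat.cast_pos.2 (NeZero.pos q)
  have hpC : (p : ℂ) ≠ 0 := Nat.cast_ne_zero.2 (NeZero.ne p)
  have hqC : (q : ℂ) ≠ 0 := Nat.cast_ne_zero.2 (NeZero.ne q)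
  -- Inversion exchanges the rational points `-c` and `1/c`, where the phases have periods `2q` and
  -- `p`. Comparing the leading behaviour of theta at both gives the reciprocity.
  set c : ℝ := p / (2 * q) with hc
  have hc0 : 0 < c := by positivity
  have hcC : (c : ℂ) ≠ 0 := Complex.ofReal_ne_zero.2 hc0.ne'
  have hcc : (c : ℂ) = p / (2 * q) := by rw [hc]; push_cast; rfl
  have hcI : ∀ s : ℝ, (c : ℂ) - Complex.I * s ≠ 0 := fun s h => by
    have := congrArg Complex.re h
    simp at this
    exact hc0.ne' this
  have : NeZero (2 * q) := ⟨mul_ne_zero two_ne_zero (NeZero.ne q)⟩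
  have T1 := tendsto_cpow_mul_jacobiTheta₂ (l := 𝓝[>] (0 : ℝ)) (2 * q) (-c)
    (fun n k => by
      rw [← Complex.exp_pi_mul_I_mul_even (-(p * k * n + p * q * k ^ 2)) (_ * (n : ℂ) ^ 2)]
      congr 1
      push_cast
      rw [hcc]; field_simp; ring)
    (ε := fun s => (s : ℂ)) (by
      filter_upwards [self_mem_nhdsWithin] with s hs
      simpa using hs)
    (by
      have : ∀ s : ℝ, ((s : ℂ)⁻¹).re = s⁻¹ := fun s => by
        rw [← Complex.ofReal_inv, Complex.ofReal_re]
      simp only [this]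
      exact tendsto_inv_nhdsGT_zero)
  have hinv : ∀ s : ℝ, ((s / (c * (c - Complex.I * s)) : ℂ)⁻¹).re = c ^ 2 * s⁻¹ := fun s => by
    rcases eq_or_ne s 0 with rfl | hs
    · simp
    have hs' : (s : ℂ) ≠ 0 := Complex.ofReal_ne_zero.2 hs
    have : (s / (c * (c - Complex.I * s)) : ℂ)⁻¹ = ((c ^ 2 * s⁻¹ : ℝ) : ℂ) - c * Complex.I := by
      push_cast
      rw [inv_div]
      field_simp
    rw [this, Complex.sub_re, Complex.ofReal_re]
    simp
  -- This `ε` parametrizes the image under inversion of the vertical approach `-c + I * s`.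
  have T2 := tendsto_cpow_mul_jacobiTheta₂ (l := 𝓝[>] (0 : ℝ)) p (1 / c)
    (fun n k => by
      rw [← Complex.exp_pi_mul_I_mul_even (2 * q * k * n + p * q * k ^ 2) (_ * (n : ℂ) ^ 2)]
      congr 1
      push_cast
      rw [hcc]; field_simp; ring)
    (ε := fun s => (s / (c * (c - Complex.I * s)) : ℂ)) (by
      filter_upwards [self_mem_nhdsWithin] with s hs
      have h1 : 0 < ((s / (c * (c - Complex.I * s)) : ℂ)⁻¹).re := by
        rw [hinv]
        have : 0 < s := hs
        positivity
      rw [Complex.inv_re] at h1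
      exact (div_pos_iff_of_pos_right (Complex.normSq_pos.2 fun h => by simp [h] at h1)).1 h1)
    (by
      simp only [hinv]
      exact tendsto_inv_nhdsGT_zero.const_mul_atTop (by positivity))
  have hrel : ∀ᶠ s : ℝ in 𝓝[>] (0 : ℝ),
      ((1 / (c * (c - Complex.I * s)) : ℂ) ^ (1 / 2 : ℂ) * (c * Complex.I + s) ^ (1 / 2 : ℂ)) *
      ((s : ℂ) ^ (1 / 2 : ℂ) * jacobiTheta₂ 0 (((-c : ℝ) : ℂ) + Complex.I * s)) =
      (s / (c * (c - Complex.I * s)) : ℂ) ^ (1 / 2 : ℂ) *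
        jacobiTheta₂ 0 (((1 / c : ℝ) : ℂ) + Complex.I * (s / (c * (c - Complex.I * s)))) := by
    filter_upwards [self_mem_nhdsWithin] with s hs
    have hs : 0 < s := hs
    rw [jacobiTheta₂_functional_equation 0 (((-c : ℝ) : ℂ) + Complex.I * s)]
    have e1 : -Complex.I * (((-c : ℝ) : ℂ) + Complex.I * s) = c * Complex.I + s := by
      push_cast; linear_combination -(s : ℂ) * Complex.I_sq
    have h2 : (((-c : ℝ) : ℂ) + Complex.I * s) ≠ 0 := by
      have := neg_ne_zero.2 (hcI s)
      rwa [neg_sub, sub_eq_neg_add, ← Complex.ofReal_neg] at this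
    have e2 : -1 / (((-c : ℝ) : ℂ) + Complex.I * s) =
        ((1 / c : ℝ) : ℂ) + Complex.I * (s / (c * (c - Complex.I * s))) := by
      have h3 := hcI s
      rw [div_eq_iff h2]
      push_cast
      field_simp
      ring
    have h4 : (c * Complex.I + s : ℂ) ≠ 0 := fun h => by
      have := congrArg Complex.im h
      simp at this
      exact hc0.ne' this
    have h5 : (c * Complex.I + s : ℂ) ^ (1 / 2 : ℂ) ≠ 0 := by
      rw [Complex.cpow_def_of_ne_zero h4]; exact Complex.exp_ne_zero _
    rw [e1, e2, zero_div, div_eq_mul_one_div (s : ℂ),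
      ofReal_mul_cpow hs (one_div_ne_zero (mul_ne_zero hcC (hcI s)))]
    simp only [ne_eq, OfNat.ofNat_ne_zero, not_false_eq_true, zero_pow, mul_zero, zero_div,
      Complex.exp_zero, mul_one]
    generalize (c * Complex.I + s : ℂ) ^ (1 / 2 : ℂ) = w at h5
    generalize (s : ℂ) ^ (1 / 2 : ℂ) = w2
    field_simp
  have T3 : Tendsto (fun s : ℝ => ((1 / (c * (c - Complex.I * s)) : ℂ) ^ (1 / 2 : ℂ) *
      (c * Complex.I + s) ^ (1 / 2 : ℂ))) (𝓝[>] 0)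
      (𝓝 ((1 / c) * (c * Complex.I) ^ (1 / 2 : ℂ))) := by
    have hs : Tendsto (fun s : ℝ => (s : ℂ)) (𝓝[>] 0) (𝓝 0) := by
      have : Tendsto (fun s : ℝ => (s : ℂ)) (𝓝 0) (𝓝 ((0 : ℝ) : ℂ)) :=
        Complex.continuous_ofReal.continuousAt
      exact (by simpa using this : Tendsto (fun s : ℝ => (s : ℂ)) (𝓝 0) (𝓝 0)).mono_left
        nhdsWithin_le_nhds
    have e1 : (1 / c : ℂ) = ((1 / (c * (c - Complex.I * 0)) : ℂ)) ^ (1 / 2 : ℂ) := by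
      have : (1 / (c * (c - Complex.I * 0)) : ℂ) = (((1 / c) ^ 2 : ℝ) : ℂ) := by
        push_cast; simp; ring
      rw [this, show (1 / 2 : ℂ) = ((1 / 2 : ℝ) : ℂ) by push_cast; rfl,
        ← Complex.ofReal_cpow (by positivity), ← Real.sqrt_eq_rpow, Real.sqrt_sq (by positivity)]
      push_cast; rfl
    have e2 : (c * Complex.I : ℂ) = c * Complex.I + 0 := (add_zero _).symm
    rw [e1]
    nth_rewrite 2 [e2]
    refine Tendsto.mul ?_ ?_
    · refine (continuousAt_cpow_const ?_).tendsto.comp ?_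
      · left
        have : (1 / (c * (c - Complex.I * 0)) : ℂ) = (((1 / c) ^ 2 : ℝ) : ℂ) := by
          push_cast; simp; ring
        rw [this, Complex.ofReal_re]
        positivity
      · refine Tendsto.div tendsto_const_nhds ?_ (by simpa using hcC)
        exact ((hs.const_mul _).const_sub _).const_mul _
    · refine (continuousAt_cpow_const ?_).tendsto.comp (hs.const_add _)
      right
      simpa using hc0.ne'
  have hlim := tendsto_nhds_unique ((T3.mul T1).congr' hrel) T2
  push_cast at hlim
  simp only [hcc] at hlim ⊢
  rw [one_div_div] at hlim
  generalize ((p : ℂ) / (2 * q) * Complex.I) ^ (1 / 2 : ℂ) = w at hlim ⊢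
  generalize ∑ n ∈ Finset.range p,
    Complex.exp (Real.pi * Complex.I * (2 * q / p) * n ^ 2) = A at hlim ⊢
  generalize ∑ x ∈ Finset.range (2 * q),
    Complex.exp (Real.pi * Complex.I * (-(p / (2 * q))) * x ^ 2) = B at hlim ⊢
  field_simp at hlim
  exact hlim.symm

/-! ### Quadratic Gauss sums modulo primes and their reciprocals. -/

/-- A quadratic Gauss sum modulo an odd prime as a Gauss sum of the quadratic character. -/
theorem sum_stdAddChar_mul_sq_eq_sum_quadraticChar (p : ℕ) [Fact p.Prime] (hp : p ≠ 2)
    {a : ZMod p} (ha : a ≠ 0) :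
    ∑ x : ZMod p, ZMod.stdAddChar (a * x ^ 2) =
      ∑ b : ZMod p, (quadraticChar (ZMod p) b : ℂ) * ZMod.stdAddChar (b * a) := by
  classical
  -- `x² = b` has `1 + χ(b)` solutions; this vanishing complete sum absorbs the `1`.
  have h0 : ∑ b : ZMod p, ZMod.stdAddChar (N := p) (b * a) = 0 := by
    rw [AddChar.sum_mulShift a (ZMod.isPrimitive_stdAddChar p), if_neg ha, Nat.cast_zero]
  rw [← Finset.sum_fiberwise Finset.univ (fun x : ZMod p => x ^ 2), ← add_zero (∑ b, _ * _), ← h0,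
    ← Finset.sum_add_distrib]
  refine Finset.sum_congr rfl fun b _ => ?_
  have hc := quadraticChar_card_sqrts (F := ZMod p) (by rwa [ZMod.ringChar_zmod_n]) b
  have hc' : ((Finset.univ.filter fun x : ZMod p => x ^ 2 = b).card : ℂ) =
      (quadraticChar (ZMod p) b : ℂ) + 1 := by
    have : (Finset.univ.filter fun x : ZMod p => x ^ 2 = b) = {x | x ^ 2 = b}.toFinset := by
      ext; simp
    rw [this]
    exact_mod_cast hc
  rw [Finset.sum_congr rfl (g := fun _ => ZMod.stdAddChar (b * a)) fun x hx => by
    rw [(Finset.mem_filter.1 hx).2, mul_comm], Finset.sum_const, nsmul_eq_mul, hc']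
  ring

theorem sum_stdAddChar_mul_sq (p : ℕ) [Fact p.Prime] (hp : p ≠ 2) {a : ZMod p} (ha : a ≠ 0) :
    ∑ x : ZMod p, ZMod.stdAddChar (a * x ^ 2) =
      (quadraticChar (ZMod p) a : ℂ) * ∑ x : ZMod p, ZMod.stdAddChar (x ^ 2) := by
  have h1 := sum_stdAddChar_mul_sq_eq_sum_quadraticChar p hp (one_ne_zero (α := ZMod p))
  simp only [one_mul, mul_one] at h1
  rw [sum_stdAddChar_mul_sq_eq_sum_quadraticChar p hp ha, h1]
  have h2 := gaussSum_mulShift ((quadraticChar (ZMod p)).ringHomComp (Int.castRingHom ℂ))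
    ZMod.stdAddChar (Units.mk0 a ha)
  simp only [gaussSum, MulChar.ringHomComp_apply, Units.val_mk0, AddChar.mulShift_apply,
    Int.coe_castRingHom] at h2
  have h3 : (quadraticChar (ZMod p) a : ℂ) * (quadraticChar (ZMod p) a : ℂ) = 1 := by
    have := quadraticChar_sq_one ha
    rw [← pow_two]
    exact_mod_cast this
  rw [← h2, ← mul_assoc, h3, one_mul]
  simp only [mul_comm a]

theorem sum_exp_sq_prime (p : ℕ) [Fact p.Prime] (hp : p ≠ 2) {d : ℕ} (hd : ¬ p ∣ d) :
    ∑ n ∈ Finset.range p, Complex.exp (Real.pi * Complex.I * (2 * d / p) * n ^ 2) =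
      (J((d : ℤ) | p) : ℂ) *
        ∑ n ∈ Finset.range p, Complex.exp (Real.pi * Complex.I * (2 * (1 : ℕ) / p) * n ^ 2) := by
  have hconv : ∀ a : ℕ, ∑ n ∈ Finset.range p,
      Complex.exp (Real.pi * Complex.I * (2 * a / p) * n ^ 2) =
      ∑ x : ZMod p, ZMod.stdAddChar ((a : ZMod p) * x ^ 2) := fun a => by
    rw [← sum_range_eq_sum_zmod]
    refine Finset.sum_congr rfl fun n _ => ?_
    have := ZMod.stdAddChar_coe (N := p) (a * n ^ 2 : ℤ)
    push_cast at this
    rw [this]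
    congr 1
    ring
  rw [hconv, hconv, sum_stdAddChar_mul_sq p hp (fun h => hd ((ZMod.natCast_eq_zero_iff _ _).1 h)),
    ← jacobiSym.legendreSym.to_jacobiSym, legendreSym]
  simp

/-- The reciprocal quadratic Gauss sum `∑ exp(-πi u x² / (2d))` over `x` modulo `2d`. -/
noncomputable def reciprocalGaussSum (d u : ℕ) : ℂ :=
  ∑ x ∈ Finset.range (2 * d), Complex.exp (Real.pi * Complex.I * (-(u / (2 * d))) * x ^ 2)

/-- Changing `u` by `4dk` moves each exponent by `2πi k x²`. This periodicity is what allows `u` to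
be replaced by a prime. -/
theorem reciprocalGaussSum_congr {d u v : ℕ} [NeZero d] (h : u ≡ v [MOD 4 * d]) :
    reciprocalGaussSum d u = reciprocalGaussSum d v := by
  have hd : (d : ℂ) ≠ 0 := Nat.cast_ne_zero.2 (NeZero.ne d)
  refine Finset.sum_congr rfl fun x _ => ?_
  obtain ⟨k, hk⟩ := (Nat.modEq_iff_dvd.1 h)
  have hk' : (v : ℂ) - u = 4 * d * k := by exact_mod_cast hk
  rw [← Complex.exp_pi_mul_I_mul_even (-(k * x ^ 2))]
  congr 1
  rw [show (u : ℂ) = v - 4 * d * k by linear_combination -hk']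
  push_cast
  field_simp
  ring

/-- Reciprocity is compared for `d` and for `1` at the same `p`: the sums modulo `p` differ by
`(d/p)`, so the reciprocal sum is `(d/p) √d (1 + exp(-πip/2))`, and the exponential is purely
imaginary for odd `p`. -/
theorem reciprocalGaussSum_prime_re (p : ℕ) [Fact p.Prime] (hp : p ≠ 2) {d : ℕ} [NeZero d]
    (hd : ¬ p ∣ d) : (reciprocalGaussSum d p).re = J((d : ℤ) | p) * √(d : ℝ) := by
  have hp0 : (0 : ℝ) < p := Nat.cast_pos.2 (NeZero.pos p)
  have hd0 : (0 : ℝ) < d := Nat.cast_pos.2 (NeZero.pos d)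
  have h1 := landsberg_schaar p d
  rw [sum_exp_sq_prime p hp hd, landsberg_schaar p 1, ← reciprocalGaussSum,
    ← reciprocalGaussSum] at h1
  have e1 : ((((p : ℝ) / (2 * d) : ℝ) : ℂ) * Complex.I) =
      ((1 / d : ℝ) : ℂ) * (((p : ℝ) / (2 * (1 : ℕ)) : ℝ) * Complex.I) := by
    push_cast; field_simp
  have hne : ((((p : ℝ) / (2 * (1 : ℕ)) : ℝ) : ℂ) * Complex.I) ≠ 0 := by
    refine mul_ne_zero (Complex.ofReal_ne_zero.2 ?_) Complex.I_ne_zero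
    positivity
  have e2 : (((1 / d : ℝ) : ℂ)) ^ (1 / 2 : ℂ) = ((1 / √(d : ℝ) : ℝ) : ℂ) := by
    rw [show (1 / 2 : ℂ) = ((1 / 2 : ℝ) : ℂ) by push_cast; rfl,
      ← Complex.ofReal_cpow (by positivity), ← Real.sqrt_eq_rpow, Real.sqrt_div zero_le_one,
      Real.sqrt_one]
  rw [e1, ofReal_mul_cpow (by positivity) hne, e2] at h1
  have hκ : ((((p : ℝ) / (2 * (1 : ℕ)) : ℝ) : ℂ) * Complex.I) ^ (1 / 2 : ℂ) ≠ 0 := by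
    rw [Complex.cpow_def_of_ne_zero hne]; exact Complex.exp_ne_zero _
  generalize ((((p : ℝ) / (2 * (1 : ℕ)) : ℝ) : ℂ) * Complex.I) ^ (1 / 2 : ℂ) = κ at h1 hκ
  have hs : √(d : ℝ) ≠ 0 := (Real.sqrt_pos.2 hd0).ne'
  have hsC : ((√(d : ℝ) : ℝ) : ℂ) ≠ 0 := Complex.ofReal_ne_zero.2 hs
  have h2 : reciprocalGaussSum d p = ((J((d : ℤ) | p) * √(d : ℝ) : ℝ) : ℂ) *
      (1 + Complex.exp (-(Real.pi * p / 2 : ℝ) * Complex.I)) := by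
    have h3 : reciprocalGaussSum 1 p =
        1 + Complex.exp (-(Real.pi * p / 2 : ℝ) * Complex.I) := by
      rw [reciprocalGaussSum, Finset.sum_range_succ, Finset.sum_range_one]
      simp only [Nat.cast_zero, Nat.cast_one]
      push_cast
      ring_nf
      simp
    rw [h3] at h1
    have h4 : κ * (((1 / √(d : ℝ) : ℝ) : ℂ) * reciprocalGaussSum d p) =
        κ * ((J((d : ℤ) | p) : ℂ) * (1 + Complex.exp (-(Real.pi * p / 2 : ℝ) * Complex.I))) := by
      linear_combination -h1
    have h5 := mul_left_cancel₀ hκ h4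
    generalize 1 + Complex.exp (-(Real.pi * p / 2 : ℝ) * Complex.I) = E at h5 ⊢
    push_cast at h5 ⊢
    field_simp at h5
    linear_combination h5
  have hcos : Real.cos (-(Real.pi * p / 2)) = 0 := by
    obtain ⟨k, hk⟩ := (Fact.out : p.Prime).odd_of_ne_two hp
    rw [Real.cos_neg, Real.cos_eq_zero_iff]
    exact ⟨k, by rw [hk]; push_cast; ring⟩
  rw [h2, Complex.re_ofReal_mul, ← Complex.ofReal_neg, Complex.add_re, Complex.exp_ofReal_mul_I_re,
    hcos]
  simp

/-! ### The Gauss sum of the Kronecker symbol, including its sign. -/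

theorem Finset.sum_range_two_mul {M : Type*} [AddCommMonoid M] (f : ℕ → M) (n : ℕ) :
    ∑ u ∈ Finset.range (2 * n), f u =
      ∑ v ∈ Finset.range n, f (2 * v) + ∑ v ∈ Finset.range n, f (2 * v + 1) := by
  induction n with
  | zero => simp
  | succ n ih =>
    rw [Nat.mul_succ, Finset.sum_range_succ, Finset.sum_range_succ, ih, Finset.sum_range_succ,
      Finset.sum_range_succ]
    abel

namespace EvenCharElliptic

theorem inv_eq_self_of_sq {d : ℕ} {ψ : DirichletCharacter ℂ d} (h2 : ψ ^ 2 = 1) : ψ⁻¹ = ψ :=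
  inv_eq_of_mul_eq_one_right (by rw [← pow_two, h2])

variable {d : ℕ} [NeZero d] {ψ : DirichletCharacter ℂ d}

/-- The Gauss sum of an induced character. -/
theorem sum_induced_gaussSum (hprim : ψ.IsPrimitive) (h2 : ψ ^ 2 = 1) (M : ℕ) [NeZero M] (y : ℤ) :
    ∑ u ∈ Finset.range (M * d), ψ u * Complex.exp (2 * Real.pi * Complex.I * (u * y) / (M * d)) =
      if (M : ℤ) ∣ y then M * ψ ((y / M : ℤ) : ZMod d) * gaussSum ψ ZMod.stdAddChar else 0 := by
  have hd : (d : ℂ) ≠ 0 := Nat.cast_ne_zero.2 (NeZero.ne d)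
  have hM : (M : ℂ) ≠ 0 := Nat.cast_ne_zero.2 (NeZero.ne M)
  -- With `u = r + d j`, the character sees only `r`, and the sum over `j` detects whether `M`
  -- divides `y`.
  have hsplit : ∑ u ∈ Finset.range (M * d),
      ψ u * Complex.exp (2 * Real.pi * Complex.I * (u * y) / (M * d)) =
      ∑ r ∈ Finset.range d, ψ r * Complex.exp (2 * Real.pi * Complex.I * (r * y) / (M * d)) *
        ∑ j ∈ Finset.range M, ZMod.stdAddChar ((j : ZMod M) * (y : ZMod M)) := by
    rw [Finset.sum_range, ← finProdFinEquiv.sum_comp, Fintype.sum_prod_type, Finset.sum_comm,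
      Finset.sum_range]
    refine Finset.sum_congr rfl fun r _ => ?_
    rw [Finset.sum_range, Finset.mul_sum]
    refine Finset.sum_congr rfl fun j _ => ?_
    have h := ZMod.stdAddChar_coe (N := M) ((j : ℕ) * y : ℤ)
    push_cast at h
    rw [h, mul_assoc (ψ _), ← Complex.exp_add, finProdFinEquiv_apply_val]
    push_cast
    simp only [CharP.cast_eq_zero, zero_mul, add_zero]
    congr 2
    field_simp
  have hinner : ∑ j ∈ Finset.range M, ZMod.stdAddChar ((j : ZMod M) * (y : ZMod M)) =
      if (M : ℤ) ∣ y then (M : ℂ) else 0 := by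
    rw [sum_range_eq_sum_zmod M (fun a => ZMod.stdAddChar (a * (y : ZMod M))),
      AddChar.sum_mulShift _ (ZMod.isPrimitive_stdAddChar M), ZMod.card]
    simp only [ZMod.intCast_zmod_eq_zero_iff_dvd]
    split_ifs <;> simp
  rw [hsplit, ← Finset.sum_mul, hinner]
  split_ifs with h
  · obtain ⟨k, rfl⟩ := h
    have hMZ : (M : ℤ) ≠ 0 := Nat.cast_ne_zero.2 (NeZero.ne M)
    rw [Int.mul_ediv_cancel_left _ hMZ, mul_assoc (M : ℂ)]
    have h3 := gaussSum_mulShift_of_isPrimitive ZMod.stdAddChar hprim (k : ZMod d)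
    rw [inv_eq_self_of_sq h2] at h3
    rw [← h3, gaussSum, ← sum_range_eq_sum_zmod, mul_comm]
    congr 1
    refine Finset.sum_congr rfl fun r _ => ?_
    have h := ZMod.stdAddChar_coe (N := d) (k * (r : ℕ) : ℤ)
    push_cast at h
    rw [AddChar.mulShift_apply, h]
    congr 2
    push_cast
    field_simp
  · rw [mul_zero]

/-- The discrete Fourier transform maps `ψ` to `G ψ`; applied twice it is `d` times reflection,
which fixes the even `ψ`. -/
theorem gaussSum_sq_eq_level (hprim : ψ.IsPrimitive) (heven : ψ.Even) (h2 : ψ ^ 2 = 1) :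
    gaussSum ψ ZMod.stdAddChar ^ 2 = d := by
  have h1 : ZMod.dft (ψ : ZMod d → ℂ) = gaussSum ψ ZMod.stdAddChar • (ψ : ZMod d → ℂ) := by
    funext k
    rw [hprim.fourierTransform_eq_inv_mul_gaussSum, inv_eq_self_of_sq h2, heven.eval_neg,
      Pi.smul_apply, smul_eq_mul, mul_comm]
  have h3 := congrFun (ZMod.dft_dft (ψ : ZMod d → ℂ)) 1
  rw [h1, map_smul, h1] at h3
  simp only [Pi.smul_apply, smul_eq_mul, map_one, mul_one, heven.eval_neg] at h3
  rw [pow_two, h3]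

theorem sq_apply_nonneg (h2 : ψ ^ 2 = 1) (a : ZMod d) : ∃ c : ℝ, 0 ≤ c ∧ c ≤ 1 ∧ ψ a ^ 2 = c := by
  by_cases ha : IsUnit a
  · refine ⟨1, zero_le_one, le_rfl, ?_⟩
    rw [← MulChar.pow_apply' ψ two_ne_zero, h2, MulChar.one_apply ha, Complex.ofReal_one]
  · exact ⟨0, le_rfl, zero_le_one, by rw [MulChar.map_nonunit _ ha]; simp⟩

/-- The twist of the reciprocal quadratic Gauss sums by `ψ` is a nonnegative multiple of the Gauss
sum of `ψ`. -/
theorem exists_sum_mul_reciprocalGaussSum (hprim : ψ.IsPrimitive) (heven : ψ.Even)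
    (h2 : ψ ^ 2 = 1) :
    ∃ C : ℝ, 0 ≤ C ∧ ∑ v ∈ Finset.range (2 * d), ψ ((2 * v + 1 : ℕ) : ZMod d) *
      reciprocalGaussSum d (2 * v + 1) = C * gaussSum ψ ZMod.stdAddChar := by
  have hd : (d : ℂ) ≠ 0 := Nat.cast_ne_zero.2 (NeZero.ne d)
  have key : ∀ x : ℕ, ∃ c : ℝ, 0 ≤ c ∧ ∑ v ∈ Finset.range (2 * d), ψ ((2 * v + 1 : ℕ) : ZMod d) *
      Complex.exp (Real.pi * Complex.I * (-(((2 * v + 1 : ℕ) : ℂ) / (2 * d))) * x ^ 2) =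
      c * gaussSum ψ ZMod.stdAddChar := by
    intro x
    -- The sum over odd `u` is the full sum modulo `4d` minus its even part, and the even part is
    -- `ψ(2)` times the sum modulo `2d`.
    have h4 := sum_induced_gaussSum hprim h2 4 (-(x ^ 2 : ℤ))
    have h5 := sum_induced_gaussSum hprim h2 2 (-(x ^ 2 : ℤ))
    rw [show 4 * d = 2 * (2 * d) by ring, Finset.sum_range_two_mul] at h4
    have e1 : ∑ v ∈ Finset.range (2 * d), ψ ((2 * v : ℕ) : ZMod d) *
        Complex.exp (2 * Real.pi * Complex.I * (((2 * v : ℕ) : ℂ) * (-(x ^ 2 : ℤ) : ℤ)) /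
          ((4 : ℕ) * d)) =
        ψ (2 : ZMod d) * ∑ u ∈ Finset.range (2 * d), ψ u *
          Complex.exp (2 * Real.pi * Complex.I * (u * (-(x ^ 2 : ℤ) : ℤ)) / ((2 : ℕ) * d)) := by
      rw [Finset.mul_sum]
      refine Finset.sum_congr rfl fun v _ => ?_
      push_cast
      rw [map_mul, mul_assoc]
      congr 3
      field_simp
      ring
    have e2 : ∑ v ∈ Finset.range (2 * d), ψ ((2 * v + 1 : ℕ) : ZMod d) *
        Complex.exp (2 * Real.pi * Complex.I * (((2 * v + 1 : ℕ) : ℂ) * (-(x ^ 2 : ℤ) : ℤ)) /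
          ((4 : ℕ) * d)) = ∑ v ∈ Finset.range (2 * d), ψ ((2 * v + 1 : ℕ) : ZMod d) *
      Complex.exp (Real.pi * Complex.I * (-(((2 * v + 1 : ℕ) : ℂ) / (2 * d))) * x ^ 2) := by
      refine Finset.sum_congr rfl fun v _ => ?_
      congr 2
      push_cast
      field_simp
      ring
    rw [e1, e2, h5] at h4
    rcases Nat.even_or_odd' x with ⟨k, rfl | rfl⟩
    · have f4 : -(((2 * k : ℕ) : ℤ) ^ 2) = (4 : ℕ) * (-(k : ℤ) ^ 2) := by push_cast; ring
      have f2 : -(((2 * k : ℕ) : ℤ) ^ 2) = (2 : ℕ) * (-(2 * (k : ℤ) ^ 2)) := by push_cast; ring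
      have q4 : -(((2 * k : ℕ) : ℤ) ^ 2) / (4 : ℕ) = -(k : ℤ) ^ 2 := by
        rw [f4, Int.mul_ediv_cancel_left _ (by norm_num)]
      have q2 : -(((2 * k : ℕ) : ℤ) ^ 2) / (2 : ℕ) = -(2 * (k : ℤ) ^ 2) := by
        rw [f2, Int.mul_ediv_cancel_left _ (by norm_num)]
      rw [if_pos ⟨_, f2⟩, if_pos ⟨_, f4⟩, q2, q4] at h4
      obtain ⟨a, ha0, -, ha⟩ := sq_apply_nonneg h2 (k : ZMod d)
      obtain ⟨b, hb0, hb1, hb⟩ := sq_apply_nonneg h2 (2 : ZMod d)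
      -- The multipliers 4 and 2 come from the two moduli; `b = ψ(2)² ≤ 1` keeps the difference
      -- nonnegative.
      refine ⟨(4 - 2 * b) * a, mul_nonneg (by linarith) ha0, ?_⟩
      push_cast at h4 ⊢
      rw [heven.eval_neg, heven.eval_neg, map_mul, map_pow, ha] at h4
      rw [← hb]
      linear_combination h4
    · have f2 : ¬ ((2 : ℕ) : ℤ) ∣ -(((2 * k + 1 : ℕ) : ℤ) ^ 2) := by
        push_cast
        rw [dvd_neg]
        intro h
        have := Int.prime_two.dvd_of_dvd_pow h
        omega
      have f4 : ¬ ((4 : ℕ) : ℤ) ∣ -(((2 * k + 1 : ℕ) : ℤ) ^ 2) := fun h =>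
        f2 ((by norm_num : ((2 : ℕ) : ℤ) ∣ ((4 : ℕ) : ℤ)).trans h)
      rw [if_neg f2, if_neg f4, mul_zero, zero_add] at h4
      exact ⟨0, le_rfl, by rw [h4]; simp⟩
  choose c hc0 hc using key
  refine ⟨∑ x ∈ Finset.range (2 * d), c x, Finset.sum_nonneg fun x _ => hc0 x, ?_⟩
  rw [Complex.ofReal_sum, Finset.sum_mul]
  simp only [reciprocalGaussSum, Finset.mul_sum]
  rw [Finset.sum_comm]
  exact Finset.sum_congr rfl fun x _ => hc x

/-- The Gauss sum of the Kronecker symbol `(d/·)` is the positive square root of `d`. -/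
theorem gaussSum_chi (hprim : ψ.IsPrimitive) (heven : ψ.Even) (h2 : ψ ^ 2 = 1)
    (hψ : ∀ n : ℕ, ψ n = chi d n) : gaussSum ψ ZMod.stdAddChar = (√(d : ℝ) : ℝ) := by
  have hd0 : (0 : ℝ) < d := Nat.cast_pos.2 (NeZero.pos d)
  obtain ⟨C, hC0, hC⟩ := exists_sum_mul_reciprocalGaussSum hprim heven h2
  have hterm : ∀ u : ℕ, Odd u →
      (ψ (u : ZMod d) * reciprocalGaussSum d u).re = (ψ (u : ZMod d) ^ 2).re * √(d : ℝ) := by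
    intro u hu
    have hreal : ψ (u : ZMod d) = ((kroneckerSymbol d u : ℝ) : ℂ) := by
      rw [hψ, chi]; push_cast; rfl
    by_cases hunit : IsUnit (u : ZMod d)
    · have hcop : Nat.Coprime u (4 * d) := by
        refine Nat.Coprime.mul_right ?_ ((ZMod.isUnit_iff_coprime u d).1 hunit)
        exact (Nat.coprime_pow_right_iff two_pos u 2).2 (Nat.coprime_two_right.2 hu)
      have : NeZero (4 * d) := ⟨mul_ne_zero four_ne_zero (NeZero.ne d)⟩
      -- Both factors depend only on `u` mod `4d`, so Dirichlet's theorem replaces `u` by a prime;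
      -- `p > 2d` ensures `p ∤ d` and `p ≠ 2`.
      obtain ⟨p, hp2, hp, hpu⟩ := Nat.forall_exists_prime_gt_and_eq_mod
        ((ZMod.isUnit_iff_coprime u (4 * d)).2 hcop) (2 * d)
      have hmod : p ≡ u [MOD 4 * d] := (ZMod.natCast_eq_natCast_iff _ _ _).1 hpu
      have hpd : ¬ p ∣ d := fun h => by
        have := Nat.le_of_dvd (NeZero.pos d) h
        omega
      have hp2' : p ≠ 2 := by
        have := NeZero.pos d
        omega
      have : Fact p.Prime := ⟨hp⟩
      have hpψ : ψ (u : ZMod d) = ((J((d : ℤ) | p) : ℝ) : ℂ) := by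
        rw [← (ZMod.natCast_eq_natCast_iff p u d).2 (hmod.of_mul_left 4), hψ, chi,
          kroneckerSymbol_odd _ (hp.odd_of_ne_two hp2')]
        push_cast; rfl
      rw [← reciprocalGaussSum_congr hmod, hpψ, Complex.re_ofReal_mul,
        reciprocalGaussSum_prime_re p hp2' hpd, ← Complex.ofReal_pow, Complex.ofReal_re]
      ring
    · rw [MulChar.map_nonunit _ hunit]; simp
  -- Each term has real part `ψ(u)² √d ≥ 0`, and `u = 1` contributes `√d`. Hence `C * Re G > 0`,
  -- which selects the positive root of `G² = d`.
  have hpos : 0 < (∑ v ∈ Finset.range (2 * d), ψ ((2 * v + 1 : ℕ) : ZMod d) *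
      reciprocalGaussSum d (2 * v + 1)).re := by
    rw [Complex.re_sum]
    refine Finset.sum_pos' (fun v _ => ?_) ⟨0, ?_, ?_⟩
    · rw [hterm _ ⟨v, rfl⟩]
      obtain ⟨c, hc0, -, hc⟩ := sq_apply_nonneg h2 ((2 * v + 1 : ℕ) : ZMod d)
      rw [hc, Complex.ofReal_re]
      positivity
    · have := NeZero.pos d
      exact Finset.mem_range.2 (by omega)
    · rw [hterm _ ⟨0, rfl⟩]
      simpa using hd0
  rw [hC, Complex.re_ofReal_mul] at hpos
  have hre : 0 < (gaussSum ψ ZMod.stdAddChar).re := (pos_iff_pos_of_mul_pos hpos).1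
    (lt_of_le_of_ne hC0 fun h => by rw [← h, zero_mul] at hpos; exact lt_irrefl _ hpos)
  have hsq : gaussSum ψ ZMod.stdAddChar ^ 2 = ((√(d : ℝ) : ℝ) : ℂ) ^ 2 := by
    rw [gaussSum_sq_eq_level hprim heven h2, ← Complex.ofReal_pow, Real.sq_sqrt hd0.le]
    simp
  rcases sq_eq_sq_iff_eq_or_eq_neg.1 hsq with h | h
  · exact h
  · rw [h, ← Complex.ofReal_neg, Complex.ofReal_re] at hre
    linarith [Real.sqrt_nonneg (d : ℝ)]

end EvenCharElliptic

/-! ### The Jacobi triple product from the q-binomial theorem. -/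

/-- The coefficients of `∏_{k < N} (1 + x q^k)` as a polynomial in `x`. -/
noncomputable def qBinomialCoeff (q : ℂ) : ℕ → ℕ → ℂ
  | 0, 0 => 1
  | 0, _ + 1 => 0
  | _ + 1, 0 => 1
  | N + 1, j + 1 => qBinomialCoeff q N (j + 1) + q ^ N * qBinomialCoeff q N j

/-- The finite product `∏_{k=1}^{n} (1 - q^k)`. -/
noncomputable def eulerProd (q : ℂ) (n : ℕ) : ℂ := ∏ k ∈ Finset.range n, (1 - q ^ (k + 1))

theorem qBinomialCoeff_zero_right (q : ℂ) (N : ℕ) : qBinomialCoeff q N 0 = 1 := by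
  cases N <;> rfl

theorem qBinomialCoeff_eq_zero (q : ℂ) {N j : ℕ} (h : N < j) : qBinomialCoeff q N j = 0 := by
  induction N generalizing j with
  | zero => obtain ⟨j, rfl⟩ := Nat.exists_eq_succ_of_ne_zero h.ne'; rfl
  | succ N ih =>
    obtain ⟨j, rfl⟩ := Nat.exists_eq_succ_of_ne_zero (by omega : j ≠ 0)
    rw [Nat.succ_eq_add_one, qBinomialCoeff, ih (by omega), ih (by omega), mul_zero, add_zero]

theorem prod_one_add_mul_pow (q x : ℂ) (N : ℕ) :
    ∏ k ∈ Finset.range N, (1 + x * q ^ k) =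
      ∑ j ∈ Finset.range (N + 1), qBinomialCoeff q N j * x ^ j := by
  induction N with
  | zero => simp [qBinomialCoeff]
  | succ N ih =>
    rw [Finset.prod_range_succ, ih, Finset.sum_range_succ' _ (N + 1)]
    simp only [qBinomialCoeff, add_mul, Finset.sum_add_distrib]
    have h1 := Finset.sum_range_succ' (fun j => qBinomialCoeff q N j * x ^ j) (N + 1)
    rw [Finset.sum_range_succ, qBinomialCoeff_eq_zero q (Nat.lt_succ_self N),
      qBinomialCoeff_zero_right] at h1
    have h2 : ∑ j ∈ Finset.range (N + 1), q ^ N * qBinomialCoeff q N j * x ^ (j + 1) =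
        (∑ j ∈ Finset.range (N + 1), qBinomialCoeff q N j * x ^ j) * (x * q ^ N) := by
      rw [Finset.sum_mul]
      exact Finset.sum_congr rfl fun j _ => by ring
    rw [h2]
    linear_combination h1

theorem eulerProd_succ (q : ℂ) (n : ℕ) : eulerProd q (n + 1) = eulerProd q n * (1 - q ^ (n + 1)) :=
  Finset.prod_range_succ _ _

/-- The closed form of the q-binomial coefficient, with denominators cleared so that no condition on
`q` is needed; it follows from the Pascal recursion. -/
theorem qBinomialCoeff_mul_eulerProd (q : ℂ) (i j : ℕ) :
    qBinomialCoeff q (i + j) j * (eulerProd q i * eulerProd q j) =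
      q ^ (j.choose 2) * eulerProd q (i + j) := by
  obtain ⟨N, hN⟩ : ∃ N, N = i + j := ⟨_, rfl⟩
  induction N generalizing i j with
  | zero =>
    obtain ⟨rfl, rfl⟩ : i = 0 ∧ j = 0 := by omega
    simp [qBinomialCoeff, eulerProd]
  | succ N ih =>
    rcases j with _ | j
    · simp [qBinomialCoeff_zero_right, eulerProd]
    have hch : (j + 1).choose 2 = j.choose 2 + j := by
      rw [Nat.choose_succ_succ' j 1, Nat.choose_one_right, add_comm]
    rcases i with _ | i
    · have h := ih 0 j (by omega)
      rw [zero_add] at h ⊢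
      rw [qBinomialCoeff, qBinomialCoeff_eq_zero q (Nat.lt_succ_self j), hch, eulerProd_succ]
      linear_combination (q ^ j * (1 - q ^ (j + 1))) * h
    · have h1 := ih i (j + 1) (by omega)
      have h2 := ih (i + 1) j (by omega)
      rw [show i + 1 + (j + 1) = (i + (j + 1)) + 1 by ring, qBinomialCoeff,
        eulerProd_succ q (i + (j + 1)), eulerProd_succ q j, eulerProd_succ q i, hch]
      rw [show i + 1 + j = i + (j + 1) by ring] at h2
      rw [hch, eulerProd_succ q j] at h1
      rw [eulerProd_succ q i] at h2
      linear_combination (1 - q ^ (i + 1)) * h1 + q ^ (i + (j + 1)) * (1 - q ^ (j + 1)) * h2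

theorem one_sub_pow_ne_zero {q : ℂ} (hq : ‖q‖ < 1) (k : ℕ) : 1 - q ^ (k + 1) ≠ 0 := fun h => by
  have h1 : ‖q ^ (k + 1)‖ < 1 := by
    rw [norm_pow]; exact pow_lt_one₀ (norm_nonneg _) hq (Nat.succ_ne_zero k)
  rw [← sub_eq_zero.1 h, norm_one] at h1
  exact lt_irrefl _ h1

theorem eulerProd_ne_zero {q : ℂ} (hq : ‖q‖ < 1) (n : ℕ) : eulerProd q n ≠ 0 :=
  Finset.prod_ne_zero_iff.2 fun k _ => one_sub_pow_ne_zero hq k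

theorem summable_norm_mul_pow {q : ℂ} (hq : ‖q‖ < 1) (x : ℂ) :
    Summable fun k : ℕ => ‖x * q ^ k‖ := by
  simp only [norm_mul, norm_pow]
  exact (summable_geometric_of_lt_one (norm_nonneg _) hq).mul_left _

theorem tendsto_prod_one_add_mul_pow {q : ℂ} (hq : ‖q‖ < 1) (x : ℂ) :
    Tendsto (fun N => ∏ k ∈ Finset.range N, (1 + x * q ^ k)) atTop
      (𝓝 (∏' k : ℕ, (1 + x * q ^ k))) :=
  (multipliable_one_add_of_summable (summable_norm_mul_pow hq x)).tendsto_prod_tprod_nat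

theorem tendsto_eulerProd {q : ℂ} (hq : ‖q‖ < 1) :
    Tendsto (eulerProd q) atTop (𝓝 (∏' k : ℕ, (1 + -q * q ^ k))) := by
  convert tendsto_prod_one_add_mul_pow hq (-q) using 2 with N
  exact Finset.prod_congr rfl fun k _ => by ring

theorem tprod_euler_ne_zero {q : ℂ} (hq : ‖q‖ < 1) : ∏' k : ℕ, (1 + -q * q ^ k) ≠ 0 := by
  refine tprod_one_add_ne_zero_of_summable (fun k => ?_) (summable_norm_mul_pow hq (-q))
  have := one_sub_pow_ne_zero hq k
  rwa [show 1 + -q * q ^ k = 1 - q ^ (k + 1) by ring]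

theorem exists_norm_le_of_tendsto {u : ℕ → ℂ} {a : ℂ} (h : Tendsto u atTop (𝓝 a)) :
    ∃ B : ℝ, 0 < B ∧ ∀ n, ‖u n‖ ≤ B := by
  obtain ⟨B, hB⟩ := h.norm.bddAbove_range
  exact ⟨max B 1, by positivity, fun n => (hB ⟨n, rfl⟩).trans (le_max_left _ _)⟩

theorem tendsto_toNat_add (n : ℤ) : Tendsto (fun N : ℕ => (N + n).toNat) atTop atTop := by
  refine tendsto_atTop.2 fun b => ?_
  filter_upwards [eventually_ge_atTop (b + n.natAbs)] with N hN
  omega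

/-- Centring the product: a factor `1 + x/q^m` with `m ≥ 1` equals `(x/q^m)(1 + q^m/x)`, which
produces the second product of the triple product. -/
theorem prod_one_add_mul_pow_shift {q x : ℂ} (hq : q ≠ 0) (hx : x ≠ 0) (N : ℕ) :
    ∏ k ∈ Finset.range (N + N), (1 + x / q ^ N * q ^ k) = x ^ N / q ^ ((N + 1).choose 2) *
      ((∏ k ∈ Finset.range N, (1 + x * q ^ k)) * ∏ k ∈ Finset.range N, (1 + q / x * q ^ k)) := by
  have hc : ∏ k ∈ Finset.range N, x / q ^ (k + 1) = x ^ N / q ^ ((N + 1).choose 2) := by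
    rw [Finset.prod_div_distrib, Finset.prod_const, Finset.card_range, Finset.prod_pow_eq_pow_sum,
      Nat.choose_two_right, ← Finset.sum_range_id_mul_two, Nat.mul_div_cancel _ two_pos,
      Finset.sum_range_succ' _ N]
    simp
  rw [Finset.prod_range_add, ← Finset.prod_range_reflect]
  have h1 : ∏ k ∈ Finset.range N, (1 + x / q ^ N * q ^ (N - 1 - k)) =
      (∏ k ∈ Finset.range N, x / q ^ (k + 1)) * ∏ k ∈ Finset.range N, (1 + q / x * q ^ k) := by
    rw [← Finset.prod_mul_distrib]
    refine Finset.prod_congr rfl fun k hk => ?_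
    obtain ⟨m, rfl⟩ : ∃ m, N = k + 1 + m := ⟨N - (k + 1), by have := Finset.mem_range.1 hk; omega⟩
    rw [show k + 1 + m - 1 - k = m by omega]
    field_simp
    ring
  have h2 : ∏ k ∈ Finset.range N, (1 + x / q ^ N * q ^ (N + k)) =
      ∏ k ∈ Finset.range N, (1 + x * q ^ k) := by
    refine Finset.prod_congr rfl fun k hk => ?_
    field_simp
    ring
  rw [h1, h2, hc]
  ring

section JacobiTripleProduct

variable {τ q x z : ℂ}

/-- The finite form of the Jacobi triple product identity. -/
theorem finite_jacobi_triple_product (hq : ‖q‖ < 1)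
    (hqτ : q = Complex.exp (2 * Real.pi * Complex.I * τ))
    (hxz : x = Complex.exp (2 * Real.pi * Complex.I * z + Real.pi * Complex.I * τ)) (N : ℕ) :
    (∏ k ∈ Finset.range N, (1 + x * q ^ k)) * ∏ k ∈ Finset.range N, (1 + q / x * q ^ k) =
      ∑ j ∈ Finset.range (2 * N + 1), eulerProd q (2 * N) /
        (eulerProd q j * eulerProd q (2 * N - j)) * jacobiTheta₂_term (j - N) z τ := by
  have hq0 : q ≠ 0 := hqτ ▸ Complex.exp_ne_zero _
  have hx0 : x ≠ 0 := hxz ▸ Complex.exp_ne_zero _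
  have h1 := prod_one_add_mul_pow_shift hq0 hx0 N
  rw [← two_mul, prod_one_add_mul_pow] at h1
  have hc : x ^ N / q ^ ((N + 1).choose 2) ≠ 0 :=
    div_ne_zero (pow_ne_zero _ hx0) (pow_ne_zero _ hq0)
  refine mul_left_cancel₀ hc ?_
  rw [← h1, Finset.mul_sum]
  refine Finset.sum_congr rfl fun j hj => ?_
  have hj' : j ≤ 2 * N := by have := Finset.mem_range.1 hj; omega
  have h2 := qBinomialCoeff_mul_eulerProd q (2 * N - j) j
  rw [Nat.sub_add_cancel hj'] at h2
  -- Completing the square: `j.choose 2 + (N+1).choose 2 - N j = ((j-N)² - (j-N))/2`, and the half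
  -- power of `q` inside `x` cancels the linear part.
  have h3 : q ^ (j.choose 2) * x ^ j * q ^ ((N + 1).choose 2) =
      x ^ N * (q ^ N) ^ j * jacobiTheta₂_term (j - N) z τ := by
    rw [hqτ, hxz, jacobiTheta₂_term]
    simp only [← Complex.exp_nat_mul, ← Complex.exp_add]
    congr 1
    rw [Nat.cast_choose_two, Nat.cast_choose_two]
    push_cast
    ring
  have e1 := eulerProd_ne_zero hq j
  have e2 := eulerProd_ne_zero hq (2 * N - j)
  have h4 : qBinomialCoeff q (2 * N) j =
      q ^ (j.choose 2) * eulerProd q (2 * N) / (eulerProd q j * eulerProd q (2 * N - j)) := by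
    rw [eq_div_iff (mul_ne_zero e1 e2), ← h2]; ring
  have h5 : jacobiTheta₂_term (j - N) z τ =
      q ^ (j.choose 2) * x ^ j * q ^ ((N + 1).choose 2) / (x ^ N * (q ^ N) ^ j) := by
    rw [h3, mul_div_cancel_left₀]
    exact mul_ne_zero (pow_ne_zero _ hx0) (pow_ne_zero _ (pow_ne_zero _ hq0))
  rw [h4, h5, div_pow]
  field_simp

/-- The Jacobi triple product identity. -/
theorem jacobi_triple_product (hτ : 0 < τ.im)
    (hqτ : q = Complex.exp (2 * Real.pi * Complex.I * τ))
    (hxz : x = Complex.exp (2 * Real.pi * Complex.I * z + Real.pi * Complex.I * τ)) :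
    jacobiTheta₂ z τ = (∏' k : ℕ, (1 + -q * q ^ k)) *
      ((∏' k : ℕ, (1 + x * q ^ k)) * ∏' k : ℕ, (1 + q / x * q ^ k)) := by
  have hq : ‖q‖ < 1 := by
    rw [hqτ, Complex.norm_exp, Real.exp_lt_one_iff]
    have : (2 * Real.pi * Complex.I * τ : ℂ).re = -(2 * Real.pi * τ.im) := by simp
    rw [this]
    have := Real.pi_pos
    nlinarith [mul_pos this hτ]
  set P := ∏' k : ℕ, (1 + -q * q ^ k) with hP
  have hP0 : P ≠ 0 := tprod_euler_ne_zero hq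
  have hE := tendsto_eulerProd hq
  rw [← hP] at hE
  have hprod := (tendsto_prod_one_add_mul_pow hq x).mul (tendsto_prod_one_add_mul_pow hq (q / x))
  let f : ℕ → ℤ → ℂ := fun N n => if n ∈ Finset.Icc (-(N : ℤ)) N then
    eulerProd q (2 * N) / (eulerProd q (N + n).toNat * eulerProd q (N + -n).toNat) *
      jacobiTheta₂_term n z τ else 0
  have hf : ∀ N, ∑' n : ℤ, f N n =
      (∏ k ∈ Finset.range N, (1 + x * q ^ k)) * ∏ k ∈ Finset.range N, (1 + q / x * q ^ k) := by
    intro N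
    rw [finite_jacobi_triple_product hq hqτ hxz,
      tsum_eq_sum (s := Finset.Icc (-(N : ℤ)) N) fun n hn => if_neg hn]
    refine Finset.sum_nbij' (fun n => (N + n).toNat) (fun j => (j : ℤ) - N) ?_ ?_ ?_ ?_ ?_
    · intro n hn
      have := Finset.mem_Icc.1 hn
      exact Finset.mem_range.2 (by omega)
    · intro j hj
      have := Finset.mem_range.1 hj
      exact Finset.mem_Icc.2 (by omega)
    · intro n hn
      have := Finset.mem_Icc.1 hn
      omega
    · intro j hj
      have := Finset.mem_range.1 hj
      omega
    · intro n hn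
      have h := Finset.mem_Icc.1 hn
      simp only [if_pos hn]
      rw [show (N + -n).toNat = 2 * N - (N + n).toNat by omega,
        show (((N + n).toNat : ℤ) - N) = n by omega]
  obtain ⟨B, hB0, hB⟩ := exists_norm_le_of_tendsto hE
  obtain ⟨D, hD0, hD⟩ := exists_norm_le_of_tendsto (hE.inv₀ hP0)
  -- Each coefficient tends to `P/(P * P)`. The Euler products and their inverses are bounded
  -- because `P ≠ 0`, so the theta series dominates.
  have hlim : Tendsto (fun N => ∑' n : ℤ, f N n) atTop
      (𝓝 (∑' n : ℤ, P / (P * P) * jacobiTheta₂_term n z τ)) := by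
    refine tendsto_tsum_of_dominated_convergence
      (bound := fun n : ℤ => B * (D * D) * ‖jacobiTheta₂_term n z τ‖) ?_ ?_ ?_
    · exact (((summable_jacobiTheta₂_term_iff z τ).2 hτ).norm).mul_left _
    · intro n
      have h1 : Tendsto (fun N : ℕ => eulerProd q (2 * N) /
          (eulerProd q (N + n).toNat * eulerProd q (N + -n).toNat) * jacobiTheta₂_term n z τ)
          atTop (𝓝 (P / (P * P) * jacobiTheta₂_term n z τ)) := by
        refine Tendsto.mul_const _ (Tendsto.div ?_ (Tendsto.mul ?_ ?_) (mul_ne_zero hP0 hP0))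
        · exact hE.comp (tendsto_id.const_mul_atTop' two_pos)
        · exact hE.comp (tendsto_toNat_add n)
        · exact hE.comp (tendsto_toNat_add (-n))
      refine h1.congr' ?_
      filter_upwards [eventually_ge_atTop n.natAbs] with N hN
      exact (if_pos (Finset.mem_Icc.2 (by omega))).symm
    · refine Eventually.of_forall fun N n => ?_
      by_cases hn : n ∈ Finset.Icc (-(N : ℤ)) N
      · simp only [f, if_pos hn]
        rw [div_eq_mul_inv, mul_inv, norm_mul, norm_mul, norm_mul]
        gcongr
        · exact hB _
        · exact hD _
        · exact hD _
      · simp only [f, if_neg hn, norm_zero]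
        positivity
  simp only [hf] at hlim
  have := tendsto_nhds_unique hprod hlim
  rw [this, tsum_mul_left, ← jacobiTheta₂]
  field_simp

end JacobiTripleProduct

/-! ### Logarithmic derivatives of the theta factors. -/

/-- A Lambert series identity. -/
theorem exists_hasSum_lambert {q y : ℂ} (hq : ‖q‖ < 1) (hy : ‖y‖ < 1) :
    ∃ S : ℂ, HasSum (fun k : ℕ => y * q ^ k / (1 - y * q ^ k)) S ∧
      HasSum (fun m : ℕ => y ^ (m + 1) / (1 - q ^ (m + 1))) S := by
  have hyk : ∀ k : ℕ, ‖y * q ^ k‖ < 1 := fun k => by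
    rw [norm_mul, norm_pow]
    exact mul_lt_one_of_nonneg_of_lt_one_left (norm_nonneg _) hy
      (pow_le_one₀ (norm_nonneg _) hq.le)
  -- The two series are the two iterated sums of this absolutely convergent double series.
  have hF : Summable fun p : ℕ × ℕ => (y * q ^ p.1) ^ (p.2 + 1) := by
    have hb : Summable fun p : ℕ × ℕ => ‖q‖ ^ p.1 * ‖y‖ ^ (p.2 + 1) :=
      (summable_geometric_of_lt_one (norm_nonneg q) hq).mul_of_nonneg
        ((summable_nat_add_iff 1).2 (summable_geometric_of_lt_one (norm_nonneg y) hy))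
        (fun _ => by positivity) (fun _ => by positivity)
    refine Summable.of_norm_bounded hb fun p => ?_
    rw [norm_pow, norm_mul, norm_pow, mul_pow, mul_comm]
    gcongr
    rw [← pow_mul]
    exact pow_le_pow_of_le_one (norm_nonneg _) hq.le (Nat.le_mul_of_pos_right _ (Nat.succ_pos _))
  refine ⟨_, hF.hasSum.prod_fiberwise fun k => ?_,
    ((Equiv.prodComm ℕ ℕ).hasSum_iff.2 hF.hasSum).prod_fiberwise fun m => ?_⟩
  · refine ((hasSum_geometric_of_norm_lt_one (hyk k)).mul_left (y * q ^ k)).of_eq fun m => ?_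
    exact pow_succ' _ _
  · have hqm : ‖q ^ (m + 1)‖ < 1 := by
      rw [norm_pow]; exact pow_lt_one₀ (norm_nonneg _) hq (Nat.succ_ne_zero m)
    refine ((hasSum_geometric_of_norm_lt_one hqm).mul_left (y ^ (m + 1))).of_eq fun k => ?_
    change (y * q ^ k) ^ (m + 1) = _
    rw [mul_pow, ← pow_mul, ← pow_mul, mul_comm k]

/-- The infinite product `∏_{k ≥ 1} (1 - q^k e^{cw})`. -/
noncomputable def thetaFactor (q c w : ℂ) : ℂ := ∏' k : ℕ, (1 + -(q * Complex.exp (c * w)) * q ^ k)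

section ThetaFactor

variable {q c w : ℂ}

theorem one_add_neg_mul_pow_ne_zero {y : ℂ} (hq : ‖q‖ < 1) (hy : ‖y‖ < 1) (k : ℕ) :
    1 + -y * q ^ k ≠ 0 := fun h => by
  have h1 : ‖y * q ^ k‖ < 1 := by
    rw [norm_mul, norm_pow]
    exact mul_lt_one_of_nonneg_of_lt_one_left (norm_nonneg _) hy
      (pow_le_one₀ (norm_nonneg _) hq.le)
  rw [show y * q ^ k = 1 by linear_combination -h, norm_one] at h1
  exact lt_irrefl _ h1

theorem thetaFactor_ne_zero (hq : ‖q‖ < 1) (hw : ‖q * Complex.exp (c * w)‖ < 1) :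
    thetaFactor q c w ≠ 0 :=
  tprod_one_add_ne_zero_of_summable (one_add_neg_mul_pow_ne_zero hq hw) (summable_norm_mul_pow hq _)

theorem isOpen_thetaFactor_domain (q c : ℂ) : IsOpen {w : ℂ | ‖q * Complex.exp (c * w)‖ < 1} :=
  isOpen_lt (by fun_prop) continuous_const

theorem multipliableLocallyUniformlyOn_thetaFactor (hq : ‖q‖ < 1) (c : ℂ) :
    MultipliableLocallyUniformlyOn (fun (k : ℕ) w => 1 + -(q * Complex.exp (c * w)) * q ^ k)
      {w : ℂ | ‖q * Complex.exp (c * w)‖ < 1} := by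
  refine Summable.multipliableLocallyUniformlyOn_nat_one_add (isOpen_thetaFactor_domain q c)
    (summable_geometric_of_lt_one (norm_nonneg q) hq) (Eventually.of_forall fun k w hw => ?_)
    fun k => by fun_prop
  rw [norm_mul, norm_neg, norm_pow]
  exact mul_le_of_le_one_left (by positivity) (le_of_lt hw)

theorem differentiableAt_thetaFactor (hq : ‖q‖ < 1) (hw : ‖q * Complex.exp (c * w)‖ < 1) :
    DifferentiableAt ℂ (thetaFactor q c) w :=
  ((multipliableLocallyUniformlyOn_thetaFactor hq c).hasProdLocallyUniformlyOn.differentiableOn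
    (.of_forall fun _ ↦ by simpa [Finset.prod_fn] using
      DifferentiableOn.finsetProd (fun _ _ ↦ by fun_prop))
    (isOpen_thetaFactor_domain q c)).differentiableAt
    ((isOpen_thetaFactor_domain q c).mem_nhds hw)

/-- The logarithmic derivative of `∏_{k ≥ 1} (1 - q^k e^{cw})` as a Lambert series. -/
theorem hasSum_logDeriv_thetaFactor (hq : ‖q‖ < 1) (hw : ‖q * Complex.exp (c * w)‖ < 1) :
    HasSum (fun m : ℕ => -c * ((q * Complex.exp (c * w)) ^ (m + 1) / (1 - q ^ (m + 1))))
      (logDeriv (thetaFactor q c) w) := by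
  obtain ⟨S, h1, h2⟩ := exists_hasSum_lambert hq hw
  have hlog : ∀ k : ℕ, logDeriv (fun w => 1 + -(q * Complex.exp (c * w)) * q ^ k) w =
      -c * (q * Complex.exp (c * w) * q ^ k / (1 - q * Complex.exp (c * w) * q ^ k)) := by
    intro k
    have hd : HasDerivAt (fun w => 1 + -(q * Complex.exp (c * w)) * q ^ k)
        (-(q * (Complex.exp (c * w) * c)) * q ^ k) w := by
      have h3 : HasDerivAt (fun w => Complex.exp (c * w)) (Complex.exp (c * w) * c) w := by
        simpa using ((hasDerivAt_id w).const_mul c).cexp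
      exact (((h3.const_mul q).neg).mul_const (q ^ k)).const_add 1
    rw [logDeriv_apply, hd.deriv]
    ring
  have hsum := (h1.mul_left (-c)).of_eq hlog
  have := logDeriv_tprod_eq_tsum (isOpen_thetaFactor_domain q c) hw
    (fun k => one_add_neg_mul_pow_ne_zero hq hw k) (fun k => by fun_prop) hsum.summable
    (multipliableLocallyUniformlyOn_thetaFactor hq c) (thetaFactor_ne_zero hq hw)
  change logDeriv (thetaFactor q c) w = _ at this
  rw [this, hsum.tsum_eq]
  exact h2.mul_left (-c)

end ThetaFactor

/-! ### Product, Fourier expansion and inversion of `θ₁`. -/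

namespace EvenCharElliptic

/-- Pairing the indices `n` and `-(n+1)` of the two-sided series forms the sines; the shift by `τ/2
+ 1/2` supplies the half-integral exponents and the signs. -/
theorem theta1_eq_jacobiTheta₂ {τ : ℂ} (hτ : 0 < τ.im) (w : ℂ) :
    theta1 w τ = -Complex.I * Complex.exp (Real.pi * Complex.I * τ / 4 + Complex.I * w) *
      jacobiTheta₂ (w / Real.pi + τ / 2 + 1 / 2) τ := by
  have hπ : (Real.pi : ℂ) ≠ 0 := Complex.ofReal_ne_zero.2 Real.pi_ne_zero
  have h := (hasSum_jacobiTheta₂_term (w / Real.pi + τ / 2 + 1 / 2) hτ).nat_add_neg_add_one.mul_left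
    (-Complex.I * Complex.exp (Real.pi * Complex.I * τ / 4 + Complex.I * w))
  rw [← h.tsum_eq, theta1, ← tsum_mul_left]
  refine tsum_congr fun n => ?_
  have hm1 : ((-1 : ℂ)) ^ n = Complex.exp (n * (Real.pi * Complex.I)) := by
    rw [Complex.exp_nat_mul, Complex.exp_pi_mul_I]
  have hq : nome τ ^ (n * (n + 1) / 2) =
      Complex.exp ((n * (n + 1) / 2 : ℂ) * (2 * Real.pi * Complex.I * τ)) := by
    rw [nome, ← Complex.exp_nat_mul, Nat.cast_div (Nat.even_mul_succ_self n).two_dvd (by norm_num)]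
    push_cast; rfl
  have e1 : Complex.exp (Real.pi * Complex.I * τ / 4 + Complex.I * w) *
      jacobiTheta₂_term n (w / Real.pi + τ / 2 + 1 / 2) τ =
      Complex.exp (2 * Real.pi * Complex.I * τ / 8) *
        ((-1 : ℂ) ^ n * nome τ ^ (n * (n + 1) / 2)) *
          Complex.exp ((2 * (n : ℂ) + 1) * w * Complex.I) := by
    rw [jacobiTheta₂_term, hm1, hq]
    simp only [← Complex.exp_add]
    congr 1
    push_cast
    field_simp
    ring
  have e2 : Complex.exp (Real.pi * Complex.I * τ / 4 + Complex.I * w) *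
      jacobiTheta₂_term (-((n : ℤ) + 1)) (w / Real.pi + τ / 2 + 1 / 2) τ =
      -(Complex.exp (2 * Real.pi * Complex.I * τ / 8) *
        ((-1 : ℂ) ^ n * nome τ ^ (n * (n + 1) / 2)) *
          Complex.exp (-((2 * (n : ℂ) + 1) * w) * Complex.I)) := by
    have hneg : ∀ z : ℂ, -z = Complex.exp (Real.pi * Complex.I) * z := fun z => by
      rw [Complex.exp_pi_mul_I]; ring
    rw [jacobiTheta₂_term, hm1, hq, hneg (_ * Complex.exp _)]
    simp only [← Complex.exp_add]
    rw [← Complex.exp_pi_mul_I_mul_even (n + 1)]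
    congr 1
    push_cast
    field_simp
    ring
  rw [Complex.sin]
  linear_combination Complex.I * e1 + Complex.I * e2

theorem norm_nome_lt_one {τ : ℂ} (hτ : 0 < τ.im) : ‖nome τ‖ < 1 := by
  rw [nome, Complex.norm_exp, Real.exp_lt_one_iff]
  have : (2 * Real.pi * Complex.I * τ : ℂ).re = -(2 * Real.pi * τ.im) := by simp
  rw [this]
  nlinarith [mul_pos Real.pi_pos hτ]

/-- The product expansion of `θ₁`. -/
theorem exists_theta1_eq_mul {τ : ℂ} (hτ : 0 < τ.im) :
    ∃ C : ℂ, C ≠ 0 ∧ ∀ w : ℂ, theta1 w τ = C * (Complex.sin w *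
      (thetaFactor (nome τ) (2 * Complex.I) w * thetaFactor (nome τ) (-(2 * Complex.I)) w)) := by
  have hq := norm_nome_lt_one hτ
  have hπ : (Real.pi : ℂ) ≠ 0 := Complex.ofReal_ne_zero.2 Real.pi_ne_zero
  refine ⟨2 * Complex.exp (Real.pi * Complex.I * τ / 4) * ∏' k : ℕ, (1 + -nome τ * nome τ ^ k),
    mul_ne_zero (mul_ne_zero two_ne_zero (Complex.exp_ne_zero _)) (tprod_euler_ne_zero hq),
    fun w => ?_⟩
  set X := Complex.exp (2 * Complex.I * w) with hX
  have hX' : Complex.exp (-(2 * Complex.I) * w) = X⁻¹ := by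
    rw [hX, ← Complex.exp_neg]; ring_nf
  have hX0 : X ≠ 0 := Complex.exp_ne_zero _
  have hx : -(nome τ * X) = Complex.exp (2 * Real.pi * Complex.I *
      (w / Real.pi + τ / 2 + 1 / 2) + Real.pi * Complex.I * τ) := by
    have hneg : ∀ z : ℂ, -z = Complex.exp (Real.pi * Complex.I) * z := fun z => by
      rw [Complex.exp_pi_mul_I]; ring
    rw [hneg, hX, nome, ← Complex.exp_add, ← Complex.exp_add]
    congr 1
    field_simp
    ring
  have hq0 : nome τ ≠ 0 := Complex.exp_ne_zero _
  have hdiv : nome τ / -(nome τ * X) = -X⁻¹ := by field_simp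
  -- The factor `k = 0` is split off because `e^{iw}(1 - e^{-2iw}) = 2i sin w`.
  have hshift : ∏' k : ℕ, (1 + -X⁻¹ * nome τ ^ k) =
      (1 - X⁻¹) * thetaFactor (nome τ) (-(2 * Complex.I)) w := by
    rw [thetaFactor, hX', tprod_eq_zero_mul']
    · rw [pow_zero, mul_one, ← sub_eq_add_neg]
      congr 1
      exact tprod_congr fun k => by ring
    · have := multipliable_one_add_of_summable (summable_norm_mul_pow hq (-(nome τ * X⁻¹)))
      exact this.congr fun k => by ring
  have hsin : Complex.exp (Complex.I * w) * (1 - X⁻¹) = 2 * Complex.I * Complex.sin w := by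
    rw [mul_sub, mul_one, ← hX', ← Complex.exp_add, Complex.sin]
    rw [show Complex.I * w + -(2 * Complex.I) * w = -w * Complex.I by ring, mul_comm Complex.I w]
    linear_combination (Complex.exp (w * Complex.I) - Complex.exp (-w * Complex.I)) * Complex.I_sq
  rw [theta1_eq_jacobiTheta₂ hτ, jacobi_triple_product hτ rfl hx, ← nome, hdiv, hshift,
    Complex.exp_add]
  change _ * (_ * (thetaFactor (nome τ) (2 * Complex.I) w * _)) = _
  linear_combination (-Complex.I * Complex.exp (Real.pi * Complex.I * τ / 4) *
    (∏' k : ℕ, (1 + -nome τ * nome τ ^ k)) * thetaFactor (nome τ) (2 * Complex.I) w *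
    thetaFactor (nome τ) (-(2 * Complex.I)) w) * hsin -
    (2 * Complex.exp (Real.pi * Complex.I * τ / 4) *
    (∏' k : ℕ, (1 + -nome τ * nome τ ^ k)) * thetaFactor (nome τ) (2 * Complex.I) w *
    thetaFactor (nome τ) (-(2 * Complex.I)) w) * Complex.sin w * Complex.I_sq

/-- `|q e^{±2iw}| = exp(-2π Im τ ∓ 2 Im w)`: in this strip neither infinite product vanishes, so
`θ₁` has only the zeros of `sin`. -/
theorem norm_nome_mul_exp_lt_one {τ w : ℂ} (hw : |w.im| < Real.pi * τ.im) :
    ‖nome τ * Complex.exp (2 * Complex.I * w)‖ < 1 ∧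
      ‖nome τ * Complex.exp (-(2 * Complex.I) * w)‖ < 1 := by
  obtain ⟨h1, h2⟩ := abs_lt.1 hw
  constructor
  · rw [nome, ← Complex.exp_add, Complex.norm_exp, Real.exp_lt_one_iff]
    simp
    linarith
  · rw [nome, ← Complex.exp_add, Complex.norm_exp, Real.exp_lt_one_iff]
    simp
    linarith

theorem theta1_ne_zero {τ w : ℂ} (hτ : 0 < τ.im) (hw : |w.im| < Real.pi * τ.im)
    (hs : Complex.sin w ≠ 0) : theta1 w τ ≠ 0 := by
  obtain ⟨C, hC, h⟩ := exists_theta1_eq_mul hτ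
  obtain ⟨h1, h2⟩ := norm_nome_mul_exp_lt_one hw
  have hq := norm_nome_lt_one hτ
  rw [h]
  exact mul_ne_zero hC (mul_ne_zero hs (mul_ne_zero (thetaFactor_ne_zero hq h1)
    (thetaFactor_ne_zero hq h2)))

/-- The Fourier expansion of the logarithmic derivative of `θ₁`. -/
theorem hasSum_theta1LogDeriv {τ w : ℂ} (hτ : 0 < τ.im) (hw : |w.im| < Real.pi * τ.im)
    (hs : Complex.sin w ≠ 0) :
    HasSum (fun m : ℕ => 4 * (nome τ ^ (m + 1) / (1 - nome τ ^ (m + 1))) *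
        Complex.sin (2 * ((m + 1 : ℕ) : ℂ) * w)) (theta1LogDeriv w τ - Complex.cot w) := by
  obtain ⟨C, hC, h⟩ := exists_theta1_eq_mul hτ
  obtain ⟨h1, h2⟩ := norm_nome_mul_exp_lt_one hw
  have hq := norm_nome_lt_one hτ
  have n1 := thetaFactor_ne_zero hq h1
  have n2 := thetaFactor_ne_zero hq h2
  have d1 := differentiableAt_thetaFactor hq h1
  have d2 := differentiableAt_thetaFactor hq h2
  have hlog : theta1LogDeriv w τ = Complex.cot w + (logDeriv (thetaFactor (nome τ) (2 * Complex.I)) w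
      + logDeriv (thetaFactor (nome τ) (-(2 * Complex.I))) w) := by
    change logDeriv (fun w => theta1 w τ) w = _
    rw [show (fun w => theta1 w τ) = _ from funext h, logDeriv_const_mul _ _ hC,
      logDeriv_mul (f := Complex.sin) (g := fun w => thetaFactor (nome τ) (2 * Complex.I) w *
        thetaFactor (nome τ) (-(2 * Complex.I)) w) _ hs (mul_ne_zero n1 n2)
        Complex.differentiableAt_sin (d1.mul d2), logDeriv_mul _ n1 n2 d1 d2, logDeriv_apply, Complex.deriv_sin, Complex.cot_eq_cos_div_sin]
  rw [hlog, add_sub_cancel_left]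
  refine ((hasSum_logDeriv_thetaFactor hq h1).add (hasSum_logDeriv_thetaFactor hq h2)).of_eq
    fun m => ?_
  rw [mul_pow, mul_pow, ← Complex.exp_nat_mul, ← Complex.exp_nat_mul, Complex.sin]
  rw [show -(2 * ((m + 1 : ℕ) : ℂ) * w) * Complex.I = ((m + 1 : ℕ) : ℂ) * (-(2 * Complex.I) * w) by
    ring, show 2 * ((m + 1 : ℕ) : ℂ) * w * Complex.I = ((m + 1 : ℕ) : ℂ) * (2 * Complex.I * w) by
    ring]
  ring

/-- The behaviour of `θ₁` under `τ ↦ -1/τ`. -/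
theorem exists_theta1_div {τ : ℂ} (hτ : 0 < τ.im) :
    ∃ κ : ℂ, κ ≠ 0 ∧ ∀ w : ℂ, theta1 (w / τ) (-1 / τ) =
      κ * (Complex.exp (Complex.I * w ^ 2 / (Real.pi * τ)) * theta1 w τ) := by
  have hπ : (Real.pi : ℂ) ≠ 0 := Complex.ofReal_ne_zero.2 Real.pi_ne_zero
  have hτ0 : τ ≠ 0 := by rintro rfl; simp at hτ
  have hτ' : 0 < (-1 / τ).im := by
    rw [neg_div, Complex.neg_im, one_div, Complex.inv_im, neg_div, neg_neg]
    exact div_pos hτ (Complex.normSq_pos.2 hτ0)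
  have hne : (-Complex.I * τ) ^ (1 / 2 : ℂ) ≠ 0 := by
    rw [Complex.cpow_def_of_ne_zero (mul_ne_zero (neg_ne_zero.2 Complex.I_ne_zero) hτ0)]
    exact Complex.exp_ne_zero _
  refine ⟨(-Complex.I * τ) ^ (1 / 2 : ℂ) * Complex.exp (-Real.pi * Complex.I / 2),
    mul_ne_zero hne (Complex.exp_ne_zero _), fun w => ?_⟩
  set u : ℂ := w / Real.pi + τ / 2 + 1 / 2 with hu
  -- The functional equation lands at `u/τ`, but `θ₁(w/τ | -1/τ)` uses `u/τ - 1/τ`;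
  -- quasi-periodicity bridges the gap.
  have hshift := jacobiTheta₂_add_left' (u / τ) (-1 / τ)
  have hu' : u / τ + -1 / τ = w / τ / Real.pi + (-1 / τ) / 2 + 1 / 2 := by
    rw [hu]; field_simp; ring
  rw [hu'] at hshift
  rw [theta1_eq_jacobiTheta₂ hτ', theta1_eq_jacobiTheta₂ hτ, ← hu,
    jacobiTheta₂_functional_equation u τ, hshift]
  have hexp : Complex.exp (Real.pi * Complex.I * (-1 / τ) / 4 + Complex.I * (w / τ)) *
      Complex.exp (-Real.pi * Complex.I * (-1 / τ + 2 * (u / τ))) =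
      Complex.exp (-Real.pi * Complex.I / 2) * (Complex.exp (Complex.I * w ^ 2 / (Real.pi * τ)) *
        (Complex.exp (Real.pi * Complex.I * τ / 4 + Complex.I * w) *
          Complex.exp (-Real.pi * Complex.I * u ^ 2 / τ))) := by
    simp only [← Complex.exp_add]
    congr 1
    rw [hu]
    field_simp
    ring
  rw [one_div ((-Complex.I * τ) ^ (1 / 2 : ℂ))]
  generalize (-Complex.I * τ) ^ (1 / 2 : ℂ) = A at hne
  have hA : A * A⁻¹ = 1 := mul_inv_cancel₀ hne
  linear_combination (-Complex.I * jacobiTheta₂ (u / τ) (-1 / τ)) * hexp -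
    (-Complex.I * jacobiTheta₂ (u / τ) (-1 / τ)) *
    (Complex.exp (-Real.pi * Complex.I / 2) * (Complex.exp (Complex.I * w ^ 2 / (Real.pi * τ)) *
        (Complex.exp (Real.pi * Complex.I * τ / 4 + Complex.I * w) *
          Complex.exp (-Real.pi * Complex.I * u ^ 2 / τ)))) * hA

theorem differentiable_theta1 {τ : ℂ} (hτ : 0 < τ.im) : Differentiable ℂ fun w => theta1 w τ := by
  have h : (fun w => theta1 w τ) = fun w => -Complex.I *
      Complex.exp (Real.pi * Complex.I * τ / 4 + Complex.I * w) *
      jacobiTheta₂ (w / Real.pi + τ / 2 + 1 / 2) τ := funext (theta1_eq_jacobiTheta₂ hτ)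
  rw [h]
  intro w
  refine DifferentiableAt.mul (by fun_prop) ?_
  exact (differentiableAt_jacobiTheta₂_fst _ hτ).comp w
    (f := fun w : ℂ => w / Real.pi + τ / 2 + 1 / 2) (by fun_prop)

/-- The behaviour of the logarithmic derivative of `θ₁` under `τ ↦ -1/τ`. -/
theorem theta1LogDeriv_div {τ : ℂ} (hτ : 0 < τ.im) {w : ℂ} (hw : theta1 w τ ≠ 0) :
    1 / τ * theta1LogDeriv (w / τ) (-1 / τ) =
      2 * Complex.I * w / (Real.pi * τ) + theta1LogDeriv w τ := by
  obtain ⟨κ, hκ, h⟩ := exists_theta1_div hτ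
  have hτ0 : τ ≠ 0 := by rintro rfl; simp at hτ
  have hτ' : 0 < (-1 / τ).im := by
    rw [neg_div, Complex.neg_im, one_div, Complex.inv_im, neg_div, neg_neg]
    exact div_pos hτ (Complex.normSq_pos.2 hτ0)
  have h1 : logDeriv ((fun w => theta1 w (-1 / τ)) ∘ fun w => w / τ) w =
      theta1LogDeriv (w / τ) (-1 / τ) * (1 / τ) := by
    rw [logDeriv_comp (differentiable_theta1 hτ' _) (by fun_prop), deriv_div_const, deriv_id'']
    rfl
  have hE : HasDerivAt (fun w => Complex.exp (Complex.I * w ^ 2 / (Real.pi * τ)))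
      (Complex.exp (Complex.I * w ^ 2 / (Real.pi * τ)) * (Complex.I * (2 * w) / (Real.pi * τ))) w := by
    have := (((hasDerivAt_pow 2 w).const_mul Complex.I).div_const (Real.pi * τ : ℂ)).cexp
    simpa using this
  have h2 : logDeriv ((fun w => theta1 w (-1 / τ)) ∘ fun w => w / τ) w =
      2 * Complex.I * w / (Real.pi * τ) + theta1LogDeriv w τ := by
    rw [show ((fun w => theta1 w (-1 / τ)) ∘ fun w => w / τ) = _ from funext h,
      logDeriv_const_mul _ _ hκ, logDeriv_mul (f := fun w => Complex.exp (Complex.I * w ^ 2 / (Real.pi * τ)))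
      (g := fun w => theta1 w τ) _ (Complex.exp_ne_zero _) hw hE.differentiableAt
      (differentiable_theta1 hτ w)]
    congr 1
    rw [logDeriv_apply, hE.deriv, mul_div_cancel_left₀ _ (Complex.exp_ne_zero _)]
    ring
  rw [← h2, h1, mul_comm]

end EvenCharElliptic

/-! ### Character sums over one period. -/

namespace EvenCharElliptic

section CharacterSums

variable {d : ℕ} [NeZero d] {ψ : DirichletCharacter ℂ d}

theorem sum_Ico_eq_sum_zmod (hd : 1 < d) (f : ZMod d → ℂ) :
    ∑ k ∈ Finset.Ico 1 d, ψ k * f k = ∑ a : ZMod d, ψ a * f a := by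
  have : Fact (1 < d) := ⟨hd⟩
  rw [← sum_range_eq_sum_zmod d (fun a => ψ a * f a), Finset.range_eq_Ico,
    Finset.sum_eq_sum_Ico_succ_bot (by omega : 0 < d), Nat.cast_zero, MulChar.map_zero, zero_mul,
    zero_add]

theorem sum_Ico_eq_zero (hd : 1 < d) (hprim : ψ.IsPrimitive) : ∑ k ∈ Finset.Ico 1 d, ψ k = 0 := by
  have hne : ψ ≠ 1 := by
    rintro rfl
    rw [DirichletCharacter.isPrimitive_def, DirichletCharacter.conductor_one] at hprim
    omega
  have := sum_Ico_eq_sum_zmod (ψ := ψ) hd (fun _ => 1)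
  simp only [mul_one] at this
  rw [this, MulChar.sum_eq_zero_of_ne_one hne]

/-- Under `k ↦ d - k`, evenness and the vanishing of `∑ ψ(k)` make the sum equal to its negative. -/
theorem sum_Ico_mul_eq_zero (hd : 1 < d) (hprim : ψ.IsPrimitive) (heven : ψ.Even) :
    ∑ k ∈ Finset.Ico 1 d, ψ k * (k : ℂ) = 0 := by
  have hrefl : ∑ k ∈ Finset.Ico 1 d, ψ k * (k : ℂ) =
      ∑ k ∈ Finset.Ico 1 d, ψ k * ((d : ℂ) - k) := by
    refine Finset.sum_nbij' (fun k => d - k) (fun k => d - k) ?_ ?_ ?_ ?_ ?_ <;> intro k hk <;>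
      have h := Finset.mem_Ico.1 hk
    · exact Finset.mem_Ico.2 (by omega)
    · exact Finset.mem_Ico.2 (by omega)
    · omega
    · omega
    · rw [Nat.cast_sub h.2.le, Nat.cast_sub h.2.le, ZMod.natCast_self, zero_sub, heven.eval_neg]
      ring
  simp only [mul_sub, Finset.sum_sub_distrib, ← Finset.sum_mul, sum_Ico_eq_zero hd hprim,
    zero_mul, zero_sub] at hrefl
  linear_combination hrefl / 2

theorem sum_Ico_mul_exp (hd : 1 < d) (hprim : ψ.IsPrimitive) (heven : ψ.Even) (h2 : ψ ^ 2 = 1)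
    (hψ : ∀ n : ℕ, ψ n = chi d n) (n : ℤ) :
    ∑ k ∈ Finset.Ico 1 d, ψ k * Complex.exp (2 * Real.pi * Complex.I * (n * k) / d) =
      ψ n * (√(d : ℝ) : ℝ) := by
  rw [← gaussSum_chi hprim heven h2 hψ]
  have h := gaussSum_mulShift_of_isPrimitive ZMod.stdAddChar hprim (n : ZMod d)
  rw [inv_eq_self_of_sq h2] at h
  rw [← h, gaussSum, ← sum_Ico_eq_sum_zmod hd]
  refine Finset.sum_congr rfl fun k _ => ?_
  have := ZMod.stdAddChar_coe (N := d) (n * (k : ℕ) : ℤ)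
  push_cast at this
  rw [AddChar.mulShift_apply, this]

/-- The two exponentials in the sine produce `ψ(n)√d` and `ψ(-n)√d`, equal by evenness, so the sine
is reassembled unshifted. -/
theorem sum_Ico_mul_sin (hd : 1 < d) (hprim : ψ.IsPrimitive) (heven : ψ.Even) (h2 : ψ ^ 2 = 1)
    (hψ : ∀ n : ℕ, ψ n = chi d n) (n : ℕ) (z : ℂ) :
    ∑ k ∈ Finset.Ico 1 d, ψ k * Complex.sin (2 * n * (z - k * Real.pi / d)) =
      ψ n * (√(d : ℝ) : ℝ) * Complex.sin (2 * n * z) := by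
  have h3 := sum_Ico_mul_exp hd hprim heven h2 hψ n
  have h4 := sum_Ico_mul_exp hd hprim heven h2 hψ (-n)
  push_cast at h3 h4
  rw [heven.eval_neg] at h4
  have hterm : ∀ k : ℕ, ψ k * Complex.sin (2 * n * (z - k * Real.pi / d)) =
      (Complex.I / 2 * Complex.exp (-(2 * n * z) * Complex.I)) *
        (ψ k * Complex.exp (2 * Real.pi * Complex.I * (n * k) / d)) -
      (Complex.I / 2 * Complex.exp (2 * n * z * Complex.I)) *
        (ψ k * Complex.exp (2 * Real.pi * Complex.I * (-n * k) / d)) := by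
    intro k
    have e1 : Complex.exp (-(2 * n * (z - k * Real.pi / d)) * Complex.I) =
        Complex.exp (-(2 * n * z) * Complex.I) *
          Complex.exp (2 * Real.pi * Complex.I * (n * k) / d) := by
      rw [← Complex.exp_add]; congr 1; ring
    have e2 : Complex.exp (2 * n * (z - k * Real.pi / d) * Complex.I) =
        Complex.exp (2 * n * z * Complex.I) *
          Complex.exp (2 * Real.pi * Complex.I * (-n * k) / d) := by
      rw [← Complex.exp_add]; congr 1; ring
    rw [Complex.sin, e1, e2]
    ring
  rw [Finset.sum_congr rfl fun k _ => hterm k, Finset.sum_sub_distrib, ← Finset.mul_sum,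
    ← Finset.mul_sum, h3, h4, Complex.sin]
  ring

end CharacterSums

theorem exists_primitive_chi_of_discr (K : Type*) [Field K] [NumberField K]
    (hK : Module.finrank ℚ K = 2) (d : ℕ) (hd : NumberField.discr K = (d : ℤ)) :
    1 < d ∧ ∃ ψ : DirichletCharacter ℂ d, (∀ n : ℕ, ψ n = chi d n) ∧ ψ.IsPrimitive ∧ ψ.Even ∧
      ψ ^ 2 = 1 := by
  have h2 := NumberField.abs_discr_gt_two (K := K) (by omega)
  obtain ⟨h4, hf⟩ := discr_quadratic_fundamental K hK
  rw [hd] at h2 h4 hf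
  rw [Nat.abs_cast] at h2
  have h1 : 1 < d := by omega
  refine ⟨h1, exists_primitive_chi h1 (by omega) fun f e hfe he => ?_⟩
  have := Int.isUnit_iff.1 (hf f e (by exact_mod_cast hfe) (by omega))
  omega

theorem sin_sub_ne_zero {d : ℕ} (hd : d ≠ 0) {z : ℂ}
    (hpole : ∀ k : ℤ, IsCoprime k (d : ℤ) → z ≠ (k : ℂ) * Real.pi / (d : ℂ)) {k : ℕ}
    (hk : Nat.Coprime k d) : Complex.sin (z - (k : ℂ) * Real.pi / (d : ℂ)) ≠ 0 := by
  intro h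
  obtain ⟨m, hm⟩ := Complex.sin_eq_zero_iff.1 h
  have hdC : (d : ℂ) ≠ 0 := Nat.cast_ne_zero.2 hd
  refine hpole (k + m * d) ((IsCoprime.add_mul_right_left_iff).2 (Nat.isCoprime_iff_coprime.2 hk)) ?_
  push_cast
  field_simp
  field_simp at hm
  linear_combination hm

end EvenCharElliptic

/-! ### Assembling the identity. -/

namespace EvenCharElliptic

/-- The identity for a real primitive even character `ψ` that agrees with `(d/·)`, in terms of the
shifted points `z - kπ/d`. -/
theorem hasSum_chi_lambert {d : ℕ} (h1 : 1 < d) {ψ : DirichletCharacter ℂ d}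
    (hψ : ∀ n : ℕ, ψ n = chi d n) (hprim : ψ.IsPrimitive) (heven : ψ.Even) (h2 : ψ ^ 2 = 1)
    {τ : ℂ} (hτ : 0 < τ.im) {z : ℂ} (hz : |z.im| < Real.pi * τ.im)
    (hpole : ∀ k : ℤ, IsCoprime k (d : ℤ) → z ≠ (k : ℂ) * Real.pi / (d : ℂ)) :
    (∀ k : ℕ, Nat.Coprime k d → theta1 ((z - (k : ℂ) * Real.pi / (d : ℂ)) / τ) (-1 / τ) ≠ 0) ∧
    (1 / τ * ∑ k ∈ Finset.Ico 1 d,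
        ψ k * theta1LogDeriv ((z - (k : ℂ) * Real.pi / (d : ℂ)) / τ) (-1 / τ) =
      ∑ k ∈ Finset.Ico 1 d, ψ k * theta1LogDeriv (z - (k : ℂ) * Real.pi / (d : ℂ)) τ) ∧
    HasSum (fun m : ℕ => 4 * (√(d : ℝ) : ℂ) * (ψ ((m + 1 : ℕ) : ZMod d) *
        (nome τ ^ (m + 1) / (1 - nome τ ^ (m + 1))) * Complex.sin (2 * ((m + 1 : ℕ) : ℂ) * z)))
      (∑ k ∈ Finset.Ico 1 d, ψ k * (theta1LogDeriv (z - (k : ℂ) * Real.pi / (d : ℂ)) τ -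
        Complex.cot (z - (k : ℂ) * Real.pi / (d : ℂ)))) := by
  have hd0 : d ≠ 0 := by omega
  have : NeZero d := ⟨hd0⟩
  have him : ∀ k : ℕ, |(z - (k : ℂ) * Real.pi / (d : ℂ)).im| < Real.pi * τ.im := fun k => by
    have : (k : ℂ) * Real.pi / (d : ℂ) = ((k * Real.pi / d : ℝ) : ℂ) := by push_cast; rfl
    rwa [this, Complex.sub_im, Complex.ofReal_im, sub_zero]
  have hθ : ∀ k : ℕ, Nat.Coprime k d → theta1 (z - (k : ℂ) * Real.pi / (d : ℂ)) τ ≠ 0 :=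
    fun k hk => theta1_ne_zero hτ (him k) (sin_sub_ne_zero hd0 hpole hk)
  have hzero : ∀ k : ℕ, ¬ Nat.Coprime k d → ψ (k : ZMod d) = 0 := fun k hk =>
    MulChar.map_nonunit _ fun h => hk ((ZMod.isUnit_iff_coprime k d).1 h)
  refine ⟨fun k hk => ?_, ?_, ?_⟩
  · obtain ⟨κ, hκ, h⟩ := exists_theta1_div hτ
    rw [h]
    exact mul_ne_zero hκ (mul_ne_zero (Complex.exp_ne_zero _) (hθ k hk))
  · have hterm : ∀ k : ℕ, 1 / τ *
        (ψ k * theta1LogDeriv ((z - (k : ℂ) * Real.pi / (d : ℂ)) / τ) (-1 / τ)) =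
        (2 * Complex.I / (Real.pi * τ) * z) * ψ k -
          (2 * Complex.I / (Real.pi * τ) * (Real.pi / d)) * (ψ k * (k : ℂ)) +
        ψ k * theta1LogDeriv (z - (k : ℂ) * Real.pi / (d : ℂ)) τ := fun k => by
      by_cases hk : Nat.Coprime k d
      · linear_combination ψ k * theta1LogDeriv_div hτ (hθ k hk)
      · rw [hzero k hk]; ring
    rw [Finset.mul_sum, Finset.sum_congr rfl fun k _ => hterm k, Finset.sum_add_distrib,
      Finset.sum_sub_distrib, ← Finset.mul_sum, ← Finset.mul_sum, sum_Ico_eq_zero h1 hprim,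
      sum_Ico_mul_eq_zero h1 hprim heven]
    ring
  · have hsum : ∀ k ∈ Finset.Ico 1 d, HasSum (fun m : ℕ => ψ (k : ZMod d) *
        (4 * (nome τ ^ (m + 1) / (1 - nome τ ^ (m + 1))) *
          Complex.sin (2 * ((m + 1 : ℕ) : ℂ) * (z - (k : ℂ) * Real.pi / (d : ℂ)))))
        (ψ (k : ZMod d) * (theta1LogDeriv (z - (k : ℂ) * Real.pi / (d : ℂ)) τ -
          Complex.cot (z - (k : ℂ) * Real.pi / (d : ℂ)))) := fun k _ => by
      by_cases hk : Nat.Coprime k d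
      · exact (hasSum_theta1LogDeriv hτ (him k) (sin_sub_ne_zero hd0 hpole hk)).mul_left _
      · simp only [hzero k hk, zero_mul]
        exact hasSum_zero
    refine (hasSum_sum hsum).of_eq fun m => ?_
    have h := sum_Ico_mul_sin h1 hprim heven h2 hψ (m + 1) z
    rw [show 4 * (√(d : ℝ) : ℂ) * (ψ ((m + 1 : ℕ) : ZMod d) *
        (nome τ ^ (m + 1) / (1 - nome τ ^ (m + 1))) * Complex.sin (2 * ((m + 1 : ℕ) : ℂ) * z)) =
      4 * (nome τ ^ (m + 1) / (1 - nome τ ^ (m + 1))) * (ψ ((m + 1 : ℕ) : ZMod d) *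
        (√(d : ℝ) : ℝ) * Complex.sin (2 * ((m + 1 : ℕ) : ℂ) * z)) by ring, ← h, Finset.mul_sum]
    exact Finset.sum_congr rfl fun k _ => by ring

end EvenCharElliptic

theorem mainTheorem12 (K : Type*) [Field K] [NumberField K] [NumberField.IsTotallyReal K]
    (hK : Module.finrank ℚ K = 2) (d : ℕ) (hd : NumberField.discr K = (d : ℤ))
    (τ : ℂ) (hτ : 0 < τ.im) (z : ℂ) (hz : |z.im| < Real.pi * τ.im)
    (hpole : ∀ k : ℤ, IsCoprime k (d : ℤ) → z ≠ (k : ℂ) * Real.pi / (d : ℂ)) :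
    (∀ k ∈ Finset.Ico 1 d, Nat.Coprime k d →
      EvenCharElliptic.theta1 (z / τ + (k : ℂ) * Real.pi * (-1 / ((d : ℂ) * τ)))
        ((d : ℂ) * (-1 / ((d : ℂ) * τ))) ≠ 0) ∧
    (Summable fun n : ℕ+ =>
      EvenCharElliptic.chi d (n : ℕ) *
        (EvenCharElliptic.nome τ ^ (n : ℕ) / (1 - EvenCharElliptic.nome τ ^ (n : ℕ))) *
          Complex.sin (2 * (n : ℂ) * z)) ∧
    1 / τ * EvenCharElliptic.g d (EvenCharElliptic.chi d) (z / τ) (-1 / ((d : ℂ) * τ)) =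
      (∑ k ∈ Finset.Ico 1 d,
          EvenCharElliptic.chi d (k : ℤ) * Complex.cot (z - (k : ℂ) * Real.pi / (d : ℂ))) +
        4 * (Real.sqrt (d : ℝ) : ℂ) *
          ∑' n : ℕ+, EvenCharElliptic.chi d (n : ℕ) *
            (EvenCharElliptic.nome τ ^ (n : ℕ) / (1 - EvenCharElliptic.nome τ ^ (n : ℕ))) *
              Complex.sin (2 * (n : ℂ) * z) := by

  obtain ⟨h1, ψ, hψ, hprim, heven, h2⟩ :=
    EvenCharElliptic.exists_primitive_chi_of_discr K hK d hd
  have hd0 : d ≠ 0 := by omega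
  have hdC : (d : ℂ) ≠ 0 := Nat.cast_ne_zero.2 hd0
  have hτ0 : τ ≠ 0 := by rintro rfl; simp at hτ
  have harg : ∀ k : ℕ, z / τ + (k : ℂ) * Real.pi * (-1 / ((d : ℂ) * τ)) =
      (z - (k : ℂ) * Real.pi / (d : ℂ)) / τ := fun k => by field_simp; ring
  have hmod : (d : ℂ) * (-1 / ((d : ℂ) * τ)) = -1 / τ := by field_simp
  obtain ⟨hθ, hg, hsum⟩ := EvenCharElliptic.hasSum_chi_lambert h1 hψ hprim heven h2 hτ hz hpole
  -- Nonvanishing lets the constant be cancelled when summability is deduced.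
  have h4 : (4 * (√(d : ℝ) : ℂ)) ≠ 0 := by
    refine mul_ne_zero (by norm_num) (Complex.ofReal_ne_zero.2 (Real.sqrt_pos.2 ?_).ne')
    exact Nat.cast_pos.2 (by omega)
  simp only [EvenCharElliptic.g, harg, hmod, ← hψ]
  refine ⟨fun k _ hk => hθ k hk, ?_, ?_⟩
  · have := summable_pnat_iff_summable_succ (f := fun n : ℕ => ψ (n : ZMod d) *
        (EvenCharElliptic.nome τ ^ n / (1 - EvenCharElliptic.nome τ ^ n)) *
          Complex.sin (2 * (n : ℂ) * z))
    exact this.2 ((summable_mul_left_iff h4).1 hsum.summable)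
  · have := tsum_pnat_eq_tsum_succ (f := fun n : ℕ => ψ (n : ZMod d) *
        (EvenCharElliptic.nome τ ^ n / (1 - EvenCharElliptic.nome τ ^ n)) *
          Complex.sin (2 * (n : ℂ) * z))
    rw [hg]
    have h5 := hsum.tsum_eq
    rw [tsum_mul_left] at h5
    simp only [mul_sub, Finset.sum_sub_distrib] at h5
    change _ = _ + _ * ∑' n : ℕ+, (fun n : ℕ => ψ (n : ZMod d) *
        (EvenCharElliptic.nome τ ^ n / (1 - EvenCharElliptic.nome τ ^ n)) *
          Complex.sin (2 * (n : ℂ) * z)) n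
    rw [this, h5]
    ring
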